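/- Let $\mathbb{C}[[\hbar]]$ be the ring of formal power series, $q=e^{\hbar}$, and let $U_\hbar=U_\hbar(\mathfrak{gl}(1|1))$ be the unital $\hbar$-adically complete $\mathbb{C}[[\hbar]]$-superalgebra topologically generated by even elements $H_1,H_2$ and odd elements $E,F$ subject to the relations $$H_1H_2=H_2H_1,\quad [H_1,E]=E,\quad [H_2,E]=-E,\quad [H_1,F]=-F,\quad [H_2,F]=F,$$ $$EF+FE=\frac{e^{\hbar(H_1+H_2)}-e^{-\hbar(H_1+H_2)}}{e^{\hbar}-e^{-\hbar}},\qquad E^2=F^2=0,$$ where $[x,y]=xy-yx$; that is, the quotient of the $\hbar$-adically completed free algebra by the $\hbar$-adic closure of the two-sided ideal generated by the relations. Write $K^{\pm1}=e^{\pm\hbar(H_1+H_2)}$. Let $\hat\otimes$ be the $\hbar$-adically completed tensor product over $\mathbb{C}[[\hbar]]$, with product $(a\otimes b)(c\otimes d)=(-1)^{|b||c|}ac\otimes bd$ on homogeneous elements. There are unique $\mathbb{C}[[\hbar]]$-algebra homomorphisms $\Delta:U_\hbar\to U_\hbar\hat\otimes U_\hbar$ and $\varepsilon:U_\hbar\to\mathbb{C}[[\hbar]]$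 and a unique $\mathbb{C}[[\hbar]]$-linear unital super anti-homomorphism $S:U_\hbar\to U_\hbar$ (that is, $S(1)=1$ and $S(xy)=(-1)^{|x||y|}S(y)S(x)$ for homogeneous $x,y$) with $$\Delta(E)=E\otimes K^{-1}+1\otimes E,\quad \Delta(F)=F\otimes 1+K\otimes F,\quad \Delta(H_i)=H_i\otimes1+1\otimes H_i,$$ $$\varepsilon(E)=\varepsilon(F)=\varepsilon(H_i)=0,\quad S(E)=-EK,\quad S(F)=-K^{-1}F,\quad S(H_i)=-H_i ,$$ and with these maps $U_\hbar$ is a (topological) Hopf superalgebra: $\Delta$, $\varepsilon$, $S$ preserve the degree, $\Delta$ is coassociative with counit $\varepsilon$, and $S$ is an antipode. This Hopf superalgebra is braided (quasitriangular) with universal $R$-matrix $$R=\Theta\Upsilon\in U_\hbar\hat\otimes U_\hbar,\qquad \Theta=1+(q-q^{-1})F\otimes E,\qquad \Upsilon=e^{\hbar(H_1\otimes H_1-H_2\otimes H_2)} .$$ That is, $R$ is invertible; $R\,\Delta(x)=\Delta^{\mathrm{op}}(x)\,R$ for all $x\in U_\hbar$, where $\Delta^{\mathrm{op}}=\sigma\circ\Delta$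 and $\sigma(a\otimes b)=(-1)^{|a||b|}b\otimes a$ on homogeneous elements; and, in $U_\hbar\hat\otimes U_\hbar\hat\otimes U_\hbar$, $$(\Delta\otimes\mathrm{id})(R)=R_{13}R_{23},\qquad(\mathrm{id}\otimes\Delta)(R)=R_{13}R_{12},$$ where $R_{12},R_{13},R_{23}$ are the images of $R$ under the continuous extensions of $a\otimes b\mapsto a\otimes b\otimes1$, $a\otimes1\otimes b$, $1\otimes a\otimes b$. -/

import Mathlib

noncomputable section

namespace SuperHopf

open TensorProduct

/-- The ground ring `ℂ[[ħ]]`; the variable `PowerSeries.X` is `ħ`. -/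
abbrev Ch : Type := PowerSeries ℂ

/-- The indeterminate `ħ`. -/
abbrev hbar : Ch := PowerSeries.X

/-- The ideal `(ħ)` of `ℂ[[ħ]]`. -/
abbrev hIdeal : Ideal Ch := Ideal.span {hbar}

/-! ### Superalgebras -/

/-- A superalgebra over `ℂ[[ħ]]`. As `2` is invertible, a `ℤ/2`-grading is the same thing as an
involutive automorphism: the parity automorphism `x ↦ (-1)^|x| x`. -/
class Superalgebra (A : Type) [Ring A] [Algebra Ch A] where
  /-- the automorphism `x ↦ (-1)^|x| x` -/
  parity : A →ₐ[Ch] A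
  parity_parity : ∀ x, parity (parity x) = x

/-- The parity automorphism `x ↦ (-1)^|x| x`. -/
abbrev parity (A : Type) [Ring A] [Algebra Ch A] [Superalgebra A] : A →ₐ[Ch] A :=
  Superalgebra.parity

section Grading

variable (A : Type) [Ring A] [Algebra Ch A] [Superalgebra A]

/-- The homogeneous elements of degree `i`. -/
def deg (i : ZMod 2) : Submodule Ch A where
  carrier := {x | parity A x = (-1 : ℤˣ) ^ i • x}
  zero_mem' := by simp
  add_mem' := by
    intro x y hx hy
    simp only [Set.mem_ofPred_eq] at hx hy ⊢
    rw [map_add, hx, hy, smul_add]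
  smul_mem' := by
    intro c x hx
    simp only [Set.mem_ofPred_eq] at hx ⊢
    rw [map_smul, hx, smul_comm]

variable {A}

theorem mem_deg {i : ZMod 2} {x : A} : x ∈ deg A i ↔ parity A x = (-1 : ℤˣ) ^ i • x := Iff.rfl

theorem mem_deg_zero {x : A} : x ∈ deg A 0 ↔ parity A x = x := by simp [mem_deg]

theorem mem_deg_one {x : A} : x ∈ deg A 1 ↔ parity A x = -x := by simp [mem_deg]

variable (A)

theorem two_half : (PowerSeries.C (1 / 2 : ℂ) : Ch) + PowerSeries.C (1 / 2 : ℂ) = 1 := by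
  rw [← map_add]; norm_num

/-- The decomposition into even and odd part. -/
def decomp : A →ₗ[Ch] DirectSum (ZMod 2) fun i => deg A i :=
  DirectSum.lof Ch (ZMod 2) (fun i => deg A i) 0 ∘ₗ
      LinearMap.codRestrict (deg A 0)
        (PowerSeries.C (1 / 2 : ℂ) • (LinearMap.id + (parity A).toLinearMap))
        (fun x => by
          rw [mem_deg_zero]
          simp [Superalgebra.parity_parity, add_comm]) +
    DirectSum.lof Ch (ZMod 2) (fun i => deg A i) 1 ∘ₗ
      LinearMap.codRestrict (deg A 1)
        (PowerSeries.C (1 / 2 : ℂ) • (LinearMap.id - (parity A).toLinearMap))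
        (fun x => by
          rw [mem_deg_one]
          simp [Superalgebra.parity_parity, ← smul_neg])

instance : GradedAlgebra (deg A) where
  one_mem := by simp [mem_deg_zero]
  mul_mem := by
    intro i j x y hx hy
    rw [mem_deg] at *
    rw [map_mul, hx, hy, smul_mul_smul_comm, uzpow_add]
  toDecomposition := DirectSum.Decomposition.ofLinearMap (deg A) (decomp A)
    (by
      ext x
      simp only [decomp, LinearMap.comp_apply, LinearMap.add_apply, map_add,
        DirectSum.coeLinearMap_lof, LinearMap.codRestrict_apply, LinearMap.smul_apply,
        LinearMap.sub_apply, LinearMap.id_apply]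
      rw [← smul_add]
      have : (x + (parity A).toLinearMap x + (x - (parity A).toLinearMap x)) = x + x := by abel
      rw [this, smul_add, ← add_smul, two_half, one_smul])
    (by
      ext i x : 2
      simp only [decomp, LinearMap.comp_apply, LinearMap.add_apply, LinearMap.id_apply,
        DirectSum.coeLinearMap_lof]
      obtain ⟨x, hx⟩ := x
      have key : ∀ y : A, (PowerSeries.C (1 / 2 : ℂ) : Ch) • (y + y) = y := fun y => by
        rw [smul_add, ← add_smul, two_half, one_smul]
      fin_cases i
      · have hx' : parity A x = x := mem_deg_zero.1 hx
        have h0 : LinearMap.codRestrict (deg A 0)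
            (PowerSeries.C (1 / 2 : ℂ) • (LinearMap.id + (parity A).toLinearMap)) (fun x => by
              rw [mem_deg_zero]
              simp [Superalgebra.parity_parity, add_comm]) x = ⟨x, hx⟩ := by
          ext; simpa [hx'] using key x
        have h1 : LinearMap.codRestrict (deg A 1)
            (PowerSeries.C (1 / 2 : ℂ) • (LinearMap.id - (parity A).toLinearMap)) (fun x => by
              rw [mem_deg_one]
              simp [Superalgebra.parity_parity, ← smul_neg]) x = 0 := by
          ext; simp [hx']
        rw [h0, h1, map_zero, add_zero]; rfl
      · have hx' : parity A x = -x := mem_deg_one.1 hx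
        have h0 : LinearMap.codRestrict (deg A 0)
            (PowerSeries.C (1 / 2 : ℂ) • (LinearMap.id + (parity A).toLinearMap)) (fun x => by
              rw [mem_deg_zero]
              simp [Superalgebra.parity_parity, add_comm]) x = 0 := by
          ext; simp [hx']
        have h1 : LinearMap.codRestrict (deg A 1)
            (PowerSeries.C (1 / 2 : ℂ) • (LinearMap.id - (parity A).toLinearMap)) (fun x => by
              rw [mem_deg_one]
              simp [Superalgebra.parity_parity, ← smul_neg]) x = ⟨x, hx⟩ := by
          ext; simpa [hx'] using key x
        rw [h0, h1, map_zero, zero_add]; rfl)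

end Grading

/-! ### Tensor products of superalgebras -/

section Tensor

variable (A B : Type) [Ring A] [Algebra Ch A] [Superalgebra A] [Ring B] [Algebra Ch B]
  [Superalgebra B]

/-- The (algebraic) tensor product over `ℂ[[ħ]]`, with product
`(a ⊗ b) (c ⊗ d) = (-1)^(|b||c|) ac ⊗ bd`. -/
abbrev STensor : Type := GradedTensorProduct Ch (deg A) (deg B)

variable {A B}

/-- The pure tensor `a ⊗ b`. -/
abbrev stmul (a : A) (b : B) : STensor A B := GradedTensorProduct.tmul Ch a b

variable (A B)

/-- `a ⊗ b` has degree `|a| + |b|`. -/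
instance : Superalgebra (STensor A B) where
  parity := GradedTensorProduct.lift (deg A) (deg B)
    ((GradedTensorProduct.includeLeft (deg A) (deg B)).comp (parity A))
    ((GradedTensorProduct.includeRight (deg A) (deg B)).comp (parity B))
    (by
      intro i j a b
      have ha : parity A a = (-1 : ℤˣ) ^ i • (a : A) := a.2
      have hb : parity B b = (-1 : ℤˣ) ^ j • (b : B) := b.2
      have e1 : stmul (parity A a) (1 : B) * stmul (1 : A) (parity B b)
          = stmul (parity A a) (parity B b) :=
        GradedTensorProduct.tmul_one_mul_one_tmul (deg A) (deg B) _ _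
      have hb' : parity B b ∈ deg B j := by
        rw [mem_deg, Superalgebra.parity_parity, hb, smul_smul, Int.units_mul_self, one_smul]
      have ha' : parity A a ∈ deg A i := by
        rw [mem_deg, Superalgebra.parity_parity, ha, smul_smul, Int.units_mul_self, one_smul]
      have e2 : stmul (1 : A) (parity B b) * stmul (parity A a) (1 : B)
          = (-1 : ℤˣ) ^ (j * i) • stmul (1 * parity A a) (parity B b * 1) :=
        GradedTensorProduct.tmul_coe_mul_coe_tmul (deg A) (deg B) 1 ⟨_, hb'⟩ ⟨_, ha'⟩ 1
      change stmul (parity A a) (1 : B) * stmul (1 : A) (parity B b) =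
        (-1 : ℤˣ) ^ (j * i) • (stmul (1 : A) (parity B b) * stmul (parity A a) (1 : B))
      rw [e1, e2, smul_smul, Int.units_mul_self, one_smul, one_mul, mul_one])
  parity_parity := by
    intro x
    rw [← AlgHom.comp_apply]
    conv_rhs => rw [← AlgHom.id_apply (R := Ch) x]
    congr 1
    have h1 : (stmul (1 : A) (1 : B)) = 1 := rfl
    ext a <;> simp [Superalgebra.parity_parity, h1]

end Tensor

/-! ### Completion -/

section Completion

variable (A : Type) [Ring A] [Algebra Ch A]

/-- The `ħ`-adic completion `lim A / ħ^n A`. -/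
def Compl : Type := AdicCompletion hIdeal A

instance : AddCommGroup (Compl A) := inferInstanceAs (AddCommGroup (AdicCompletion hIdeal A))
instance : Module Ch (Compl A) := inferInstanceAs (Module Ch (AdicCompletion hIdeal A))

variable {A}

/-- The canonical map from `A` to its completion. -/
def toCompl : A →ₗ[Ch] Compl A := AdicCompletion.of hIdeal A

/-- The component in `A / ħ^n A`. -/
def comp (n : ℕ) : Compl A →ₗ[Ch] A ⧸ (hIdeal ^ n • ⊤ : Submodule Ch A) :=
  AdicCompletion.eval hIdeal A n

theorem Compl.ext {x y : Compl A} (h : ∀ n, comp n x = comp n y) : x = y :=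
  AdicCompletion.ext h

theorem comp_toCompl (n : ℕ) (a : A) : comp n (toCompl a) = Submodule.Quotient.mk a := rfl

theorem comp_trans {m n : ℕ} (h : m ≤ n) (x : Compl A) :
    AdicCompletion.transitionMap hIdeal A h (comp n x) = comp m x :=
  AdicCompletion.transitionMap_comp_eval_apply hIdeal A h x

theorem trans_mk {m n : ℕ} (h : m ≤ n) (a : A) :
    AdicCompletion.transitionMap hIdeal A h (Submodule.Quotient.mk a)
      = Submodule.Quotient.mk a := rfl

/-- The multiplication of `A / ħ^n A`. -/
def quotMul (n : ℕ) : (A ⧸ (hIdeal ^ n • ⊤ : Submodule Ch A)) →ₗ[Ch]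
    (A ⧸ (hIdeal ^ n • ⊤ : Submodule Ch A)) →ₗ[Ch] (A ⧸ (hIdeal ^ n • ⊤ : Submodule Ch A)) :=
  Submodule.liftQ _
    (Submodule.mapQLinear _ _ ∘ₗ
      LinearMap.codRestrict (Submodule.compatibleMaps _ _) (LinearMap.mul Ch A) (fun a => by
        change (hIdeal ^ n • ⊤ : Submodule Ch A) ≤ Submodule.comap _ (hIdeal ^ n • ⊤)
        exact Submodule.smul_top_le_comap_smul_top _ _))
    (by
      refine (Submodule.smul_le).2 fun r hr a _ => ?_
      rw [LinearMap.mem_ker, map_smul]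
      ext b
      change Submodule.Quotient.mk (r • (a * b)) = 0
      rw [Submodule.Quotient.mk_eq_zero]
      exact Submodule.smul_mem_smul hr trivial)

theorem quotMul_mk (n : ℕ) (a b : A) :
    quotMul n (Submodule.Quotient.mk a) (Submodule.Quotient.mk b)
      = Submodule.Quotient.mk (a * b) := rfl

instance : Mul (Compl A) where
  mul x y := ⟨fun n => quotMul n (comp n x) (comp n y), by
    intro m n h
    change AdicCompletion.transitionMap hIdeal A h (quotMul n (comp n x) (comp n y))
      = quotMul m (comp m x) (comp m y)
    rw [← comp_trans h x, ← comp_trans h y]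
    obtain ⟨a, ha⟩ := Submodule.Quotient.mk_surjective _ (comp n x)
    obtain ⟨b, hb⟩ := Submodule.Quotient.mk_surjective _ (comp n y)
    rw [← ha, ← hb, quotMul_mk, trans_mk, trans_mk, trans_mk, quotMul_mk]⟩

instance : One (Compl A) where
  one := toCompl 1

theorem comp_mul (n : ℕ) (x y : Compl A) : comp n (x * y) = quotMul n (comp n x) (comp n y) := rfl

theorem comp_one (n : ℕ) : comp n (1 : Compl A) = Submodule.Quotient.mk 1 := rfl

instance : Ring (Compl A) :=
  { (inferInstance : AddCommGroup (Compl A)), (inferInstance : Mul (Compl A)),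
    (inferInstance : One (Compl A)) with
    left_distrib := fun x y z => Compl.ext fun n => by simp [comp_mul]
    right_distrib := fun x y z => Compl.ext fun n => by simp [comp_mul]
    zero_mul := fun x => Compl.ext fun n => by simp [comp_mul]
    mul_zero := fun x => Compl.ext fun n => by simp [comp_mul]
    one_mul := fun x => Compl.ext fun n => by
      obtain ⟨a, ha⟩ := Submodule.Quotient.mk_surjective _ (comp n x)
      rw [comp_mul, comp_one, ← ha, quotMul_mk, one_mul]
    mul_one := fun x => Compl.ext fun n => by
      obtain ⟨a, ha⟩ := Submodule.Quotient.mk_surjective _ (comp n x)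
      rw [comp_mul, comp_one, ← ha, quotMul_mk, mul_one]
    mul_assoc := fun x y z => Compl.ext fun n => by
      obtain ⟨a, ha⟩ := Submodule.Quotient.mk_surjective _ (comp n x)
      obtain ⟨b, hb⟩ := Submodule.Quotient.mk_surjective _ (comp n y)
      obtain ⟨c, hc⟩ := Submodule.Quotient.mk_surjective _ (comp n z)
      simp only [comp_mul, ← ha, ← hb, ← hc, quotMul_mk, mul_assoc] }

instance : Algebra Ch (Compl A) :=
  Algebra.ofModule
    (fun r x y => Compl.ext fun n => by simp [comp_mul])
    (fun r x y => Compl.ext fun n => by simp [comp_mul])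

variable {B : Type} [Ring B] [Algebra Ch B]

theorem smul_top_le_ker (n : ℕ) (f : A →ₗ[Ch] B ⧸ (hIdeal ^ n • ⊤ : Submodule Ch B)) :
    (hIdeal ^ n • ⊤ : Submodule Ch A) ≤ f.ker := by
  refine (Submodule.smul_le).2 fun r hr a _ => ?_
  rw [LinearMap.mem_ker, map_smul]
  obtain ⟨b, hb⟩ := Submodule.Quotient.mk_surjective _ (f a)
  rw [← hb, ← Submodule.Quotient.mk_smul, Submodule.Quotient.mk_eq_zero]
  exact Submodule.smul_mem_smul hr trivial

/-- A linear map `A → B / ħ^n B` factors through `A / ħ^n A`. -/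
def descend (n : ℕ) (f : A →ₗ[Ch] B ⧸ (hIdeal ^ n • ⊤ : Submodule Ch B)) :
    (A ⧸ (hIdeal ^ n • ⊤ : Submodule Ch A)) →ₗ[Ch] B ⧸ (hIdeal ^ n • ⊤ : Submodule Ch B) :=
  Submodule.liftQ _ f (smul_top_le_ker n f)

theorem descend_mk (n : ℕ) (f : A →ₗ[Ch] B ⧸ (hIdeal ^ n • ⊤ : Submodule Ch B)) (a : A) :
    descend n f (Submodule.Quotient.mk a) = f a := Submodule.liftQ_apply _ f a

/-- The extension by continuity of a `ℂ[[ħ]]`-linear map `f : A → B^` to the completion of `A`. -/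
def extend (f : A →ₗ[Ch] Compl B) : Compl A →ₗ[Ch] Compl B :=
  AdicCompletion.lift hIdeal (fun n => descend n (comp n ∘ₗ f) ∘ₗ comp n)
    (by
      intro m n h
      refine LinearMap.ext fun x => ?_
      obtain ⟨a, ha⟩ := Submodule.Quotient.mk_surjective _ (comp n x)
      have ha' : comp m x = Submodule.Quotient.mk a := by rw [← comp_trans h x, ← ha, trans_mk]
      simp only [LinearMap.comp_apply, ← ha, ha', descend_mk]
      exact comp_trans h (f a))

theorem comp_extend' (f : A →ₗ[Ch] Compl B) (n : ℕ) (x : Compl A) :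
    comp n (extend f x) = descend n (comp n ∘ₗ f) (comp n x) := rfl

theorem comp_extend (f : A →ₗ[Ch] Compl B) (n : ℕ) (x : Compl A) (a : A)
    (h : comp n x = Submodule.Quotient.mk a) : comp n (extend f x) = comp n (f a) := by
  rw [comp_extend', h, descend_mk, LinearMap.comp_apply]

/-- The map of completions induced by a linear map. -/
def cmap (f : A →ₗ[Ch] B) : Compl A →ₗ[Ch] Compl B := extend (toCompl ∘ₗ f)

theorem comp_cmap (f : A →ₗ[Ch] B) (n : ℕ) (x : Compl A) (a : A)
    (h : comp n x = Submodule.Quotient.mk a) :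
    comp n (cmap f x) = Submodule.Quotient.mk (f a) := comp_extend _ n x a h

/-- The map of completions induced by an algebra homomorphism. -/
def cmapAlg (f : A →ₐ[Ch] B) : Compl A →ₐ[Ch] Compl B :=
  AlgHom.ofLinearMap (cmap f.toLinearMap)
    (Compl.ext fun n => by
      rw [comp_cmap _ n 1 1 (comp_one n)]
      simp [comp_one])
    (fun x y => Compl.ext fun n => by
      obtain ⟨a, ha⟩ := Submodule.Quotient.mk_surjective _ (comp n x)
      obtain ⟨b, hb⟩ := Submodule.Quotient.mk_surjective _ (comp n y)
      rw [comp_cmap _ n (x * y) (a * b) (by rw [comp_mul, ← ha, ← hb, quotMul_mk]), comp_mul,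
        comp_cmap _ n x a ha.symm, comp_cmap _ n y b hb.symm, quotMul_mk]
      simp)

/-- The grading of the completion. -/
instance [Superalgebra A] : Superalgebra (Compl A) where
  parity := cmapAlg (parity A)
  parity_parity := fun x => Compl.ext fun n => by
    obtain ⟨a, ha⟩ := Submodule.Quotient.mk_surjective _ (comp n x)
    have h1 := comp_cmap (parity A).toLinearMap n x a ha.symm
    have h2 := comp_cmap (parity A).toLinearMap n _ _ h1
    refine h2.trans ?_
    rw [← ha]
    simp [Superalgebra.parity_parity]

/-- The convergent sum `∑ ħ^m f m`. -/
def hSum (f : ℕ → Compl A) : Compl A :=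
  ⟨fun n => ∑ m ∈ Finset.range n, hbar ^ m • comp n (f m), by
    intro k n h
    rw [map_sum]
    have e : ∀ m, AdicCompletion.transitionMap hIdeal A h (hbar ^ m • comp n (f m))
        = hbar ^ m • comp k (f m) := fun m => by
      rw [map_smul]; congr 1; exact comp_trans h (f m)
    simp only [e]
    symm
    refine Finset.sum_subset (Finset.range_mono h) fun m _ hm => ?_
    have hkm : k ≤ m := by simpa using hm
    obtain ⟨b, hb⟩ := Submodule.Quotient.mk_surjective _ (comp k (f m))
    rw [← hb, ← Submodule.Quotient.mk_smul, Submodule.Quotient.mk_eq_zero]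
    exact Submodule.smul_mem_smul (Ideal.pow_le_pow_right hkm
      (Ideal.pow_mem_pow (Ideal.mem_span_singleton_self _) m)) trivial⟩

theorem comp_hSum (f : ℕ → Compl A) (n : ℕ) :
    comp n (hSum f) = ∑ m ∈ Finset.range n, hbar ^ m • comp n (f m) := rfl

/-- The exponential `e^(ħ a) = ∑ ħ^m a^m / m!`. -/
def hExp (a : Compl A) : Compl A :=
  hSum fun m => (PowerSeries.C ((m.factorial : ℂ)⁻¹) : Ch) • a ^ m

/-- `q = e^ħ`. -/
def q : Ch := PowerSeries.exp ℂ

/-- The invertible power series `(q - q⁻¹) / ħ`. -/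
def qDiff : Ch := PowerSeries.mk fun n => PowerSeries.coeff (n + 1) (q - q⁻¹)

/-- The quotient `(e^(ħ a) - e^(-ħ a)) / (e^ħ - e^(-ħ))`, that is
`((q - q⁻¹) / ħ)⁻¹ ∑ ħ^m (1 - (-1)^(m+1)) / (m+1)! a^(m+1)`. -/
def bracket (a : Compl A) : Compl A :=
  qDiff⁻¹ • hSum fun m =>
    (PowerSeries.C ((1 - (-1) ^ (m + 1)) / ((m + 1).factorial : ℂ)) : Ch) • a ^ (m + 1)

theorem hbar_mul_qDiff : hbar * qDiff = q - q⁻¹ := by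
  have h := PowerSeries.sub_const_eq_X_mul_shift (q - q⁻¹)
  have h0 : PowerSeries.constantCoeff (q - q⁻¹) = 0 := by
    simp [q, PowerSeries.constantCoeff_inv]
  rw [h0, map_zero, sub_zero] at h
  exact h.symm

theorem constantCoeff_qDiff : PowerSeries.constantCoeff qDiff = 2 := by
  have h : q * q⁻¹ = 1 := PowerSeries.mul_inv_cancel _ (by simp [q])
  have h1 := congrArg (PowerSeries.coeff 1) h
  rw [PowerSeries.coeff_mul, Finset.Nat.sum_antidiagonal_eq_sum_range_succ_mk] at h1
  simp [Finset.sum_range_succ, q, PowerSeries.coeff_exp, PowerSeries.coeff_one] at h1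
  rw [← PowerSeries.coeff_zero_eq_constantCoeff_apply, qDiff, PowerSeries.coeff_mk]
  simp only [map_sub, q, PowerSeries.coeff_exp]
  simp
  linear_combination -h1

theorem hbar_pow_smul_quot (n : ℕ) (x : A ⧸ (hIdeal ^ n • ⊤ : Submodule Ch A)) :
    hbar ^ n • x = 0 := by
  obtain ⟨b, hb⟩ := Submodule.Quotient.mk_surjective _ x
  rw [← hb, ← Submodule.Quotient.mk_smul, Submodule.Quotient.mk_eq_zero]
  exact Submodule.smul_mem_smul (Ideal.pow_mem_pow (Ideal.mem_span_singleton_self _) n) trivial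

/-- `bracket a` is indeed the quotient of `e^(ħ a) - e^(-ħ a)` by `q - q⁻¹`. -/
theorem smul_bracket (a : Compl A) : (q - q⁻¹) • bracket a = hExp a - hExp (-a) := by
  have hq : qDiff * qDiff⁻¹ = 1 :=
    PowerSeries.mul_inv_cancel _ (by rw [constantCoeff_qDiff]; norm_num)
  rw [← hbar_mul_qDiff, bracket, smul_smul, mul_assoc, hq, mul_one]
  refine Compl.ext fun n => ?_
  rw [map_smul, map_sub, hExp, hExp, comp_hSum, comp_hSum, comp_hSum, Finset.smul_sum,
    ← Finset.sum_sub_distrib]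
  let g : ℕ → A ⧸ (hIdeal ^ n • ⊤ : Submodule Ch A) := fun m =>
    hbar ^ m • comp n ((PowerSeries.C ((1 - (-1) ^ m) / (m.factorial : ℂ)) : Ch) • a ^ m)
  have e1 : ∀ m, hbar • hbar ^ m • comp n ((PowerSeries.C ((1 - (-1) ^ (m + 1)) /
      ((m + 1).factorial : ℂ)) : Ch) • a ^ (m + 1)) = g (m + 1) := fun m => by
    rw [smul_smul, ← pow_succ']
  have e2 : ∀ m, hbar ^ m • comp n ((PowerSeries.C ((m.factorial : ℂ)⁻¹) : Ch) • a ^ m) -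
      hbar ^ m • comp n ((PowerSeries.C ((m.factorial : ℂ)⁻¹) : Ch) • (-a) ^ m) = g m := fun m => by
    have hp : (-a) ^ m = (PowerSeries.C ((-1 : ℂ) ^ m) : Ch) • a ^ m := by
      rcases Nat.even_or_odd m with h | h
      · rw [h.neg_pow, h.neg_one_pow, map_one, one_smul]
      · rw [h.neg_pow, h.neg_one_pow, map_neg, map_one, neg_smul, one_smul]
    rw [← smul_sub, ← map_sub, hp, smul_smul, ← sub_smul, ← map_mul, ← map_sub]
    simp only [g]
    congr 5
    ring
  simp only [e1, e2]
  have h0 : g 0 = 0 := by simp [g]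
  have hn : g n = 0 := hbar_pow_smul_quot n _
  have := Finset.sum_range_succ g n
  rw [Finset.sum_range_succ', h0, hn, add_zero, add_zero] at this
  exact this

theorem cmapAlg_hSum (f : A →ₐ[Ch] B) (g : ℕ → Compl A) :
    cmapAlg f (hSum g) = hSum fun m => cmapAlg f (g m) := Compl.ext fun n => by
  have hg : ∀ m, ∃ a : A, comp n (g m) = Submodule.Quotient.mk a := fun m =>
    (Submodule.Quotient.mk_surjective _ (comp n (g m))).imp fun _ h => h.symm
  choose a ha using hg
  have e : ∀ m, comp n (cmapAlg f (g m)) = Submodule.Quotient.mk (f (a m)) := fun m =>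
    comp_cmap f.toLinearMap n (g m) (a m) (ha m)
  refine (comp_cmap f.toLinearMap n (hSum g) (∑ m ∈ Finset.range n, hbar ^ m • a m) ?_).trans ?_
  · rw [comp_hSum]
    simp only [ha, ← Submodule.mkQ_apply, map_sum, map_smul]
  · rw [comp_hSum]
    simp only [e, ← Submodule.mkQ_apply, map_sum, map_smul, AlgHom.toLinearMap_apply]

theorem cmapAlg_bracket (f : A →ₐ[Ch] B) (a : Compl A) :
    cmapAlg f (bracket a) = bracket (cmapAlg f a) := by
  simp only [bracket, map_smul, cmapAlg_hSum, map_pow]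

end Completion

/-! ### Braided Hopf superalgebras -/

section Hopf

variable (A : Type) [Ring A] [Algebra Ch A] [Superalgebra A]

/-- The completed tensor product of two copies of `A`. -/
abbrev T2 : Type := Compl (STensor A A)

/-- The completed tensor product of three copies of `A`. -/
abbrev T3 : Type := Compl (STensor (STensor A A) A)

variable {A}

/-- The element `a ⊗ b` of the completed tensor product. -/
def tens (a b : A) : T2 A := toCompl (stmul a b)

/-- The graded flip `a ⊗ b ↦ (-1)^(|a||b|) b ⊗ a`, extended by continuity. -/
def flip : T2 A →ₗ[Ch] T2 A :=
  cmap (GradedTensorProduct.comm (deg A) (deg A)).toLinearMap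

/-- `a ⊗ b ↦ a ⊗ b ⊗ 1`, extended by continuity. -/
def leg12 : T2 A →ₗ[Ch] T3 A :=
  cmap (GradedTensorProduct.includeLeft (deg (STensor A A)) (deg A)).toLinearMap

/-- `(f ⊗ id)` on the algebraic tensor product, for `f` linear from `A` to `A ⊗ A`. -/
def mapLeft (f : A →ₗ[Ch] STensor A A) : STensor A A →ₗ[Ch] STensor (STensor A A) A :=
  (GradedTensorProduct.of Ch (deg (STensor A A)) (deg A)).toLinearMap ∘ₗ
    TensorProduct.map f LinearMap.id ∘ₗ
    (GradedTensorProduct.of Ch (deg A) (deg A)).symm.toLinearMap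

/-- `a ⊗ b ↦ a ⊗ 1 ⊗ b`, extended by continuity. -/
def leg13 : T2 A →ₗ[Ch] T3 A :=
  cmap (mapLeft (GradedTensorProduct.includeLeft (deg A) (deg A)).toLinearMap)

/-- `a ⊗ b ↦ 1 ⊗ a ⊗ b`, extended by continuity. -/
def leg23 : T2 A →ₗ[Ch] T3 A :=
  cmap (mapLeft (GradedTensorProduct.includeRight (deg A) (deg A)).toLinearMap)

/-- `x ↦ x ⊗ b` from `A ⊗ A` to `A ⊗ A ⊗ A`. -/
def appendRight (b : A) : STensor A A →ₗ[Ch] STensor (STensor A A) A :=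
  (GradedTensorProduct.of Ch (deg (STensor A A)) (deg A)).toLinearMap ∘ₗ
    (TensorProduct.mk Ch (STensor A A) A).flip b

/-- `x ↦ a ⊗ x` from `A ⊗ A` to `A ⊗ A ⊗ A`, that is `b ⊗ c ↦ (a ⊗ b) ⊗ c`. -/
def appendLeft (a : A) : STensor A A →ₗ[Ch] STensor (STensor A A) A :=
  mapLeft ((GradedTensorProduct.of Ch (deg A) (deg A)).toLinearMap ∘ₗ TensorProduct.mk Ch A A a)

/-- `Δ ⊗ id`, that is `a ⊗ b ↦ Δ(a) ⊗ b`, extended by continuity. -/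
def coprodLeft (Δ : A →ₐ[Ch] T2 A) : T2 A →ₗ[Ch] T3 A :=
  extend (TensorProduct.lift (LinearMap.mk₂ Ch (fun a b => cmap (appendRight b) (Δ a))
      (fun a a' b => by rw [map_add, map_add])
      (fun c a b => by rw [map_smul, map_smul])
      (fun a b b' => Compl.ext fun n => by
        obtain ⟨x, hx⟩ := Submodule.Quotient.mk_surjective _ (comp n (Δ a))
        rw [map_add (comp n)]
        simp only [comp_cmap _ n (Δ a) x hx.symm]
        simp only [appendRight, map_add, LinearMap.comp_add, LinearMap.add_apply,
          Submodule.Quotient.mk_add])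
      (fun c a b => Compl.ext fun n => by
        obtain ⟨x, hx⟩ := Submodule.Quotient.mk_surjective _ (comp n (Δ a))
        rw [map_smul (comp n)]
        simp only [comp_cmap _ n (Δ a) x hx.symm]
        simp only [appendRight, map_smul, LinearMap.comp_smul, LinearMap.smul_apply,
          Submodule.Quotient.mk_smul])) ∘ₗ
    (GradedTensorProduct.of Ch (deg A) (deg A)).symm.toLinearMap)

/-- `id ⊗ Δ`, that is `a ⊗ b ↦ a ⊗ Δ(b)`, extended by continuity. -/
def coprodRight (Δ : A →ₐ[Ch] T2 A) : T2 A →ₗ[Ch] T3 A :=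
  extend (TensorProduct.lift (LinearMap.mk₂ Ch (fun a b => cmap (appendLeft a) (Δ b))
      (fun a a' b => Compl.ext fun n => by
        obtain ⟨x, hx⟩ := Submodule.Quotient.mk_surjective _ (comp n (Δ b))
        rw [map_add (comp n)]
        simp only [comp_cmap _ n (Δ b) x hx.symm]
        simp only [appendLeft, mapLeft, map_add, LinearMap.comp_add, LinearMap.add_comp,
          TensorProduct.map_add_left, LinearMap.add_apply, Submodule.Quotient.mk_add])
      (fun c a b => Compl.ext fun n => by
        obtain ⟨x, hx⟩ := Submodule.Quotient.mk_surjective _ (comp n (Δ b))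
        rw [map_smul (comp n)]
        simp only [comp_cmap _ n (Δ b) x hx.symm]
        simp only [appendLeft, mapLeft, map_smul, LinearMap.comp_smul, LinearMap.smul_comp,
          TensorProduct.map_smul_left, LinearMap.smul_apply, Submodule.Quotient.mk_smul])
      (fun a b b' => by rw [map_add, map_add])
      (fun c a b => by rw [map_smul, map_smul])) ∘ₗ
    (GradedTensorProduct.of Ch (deg A) (deg A)).symm.toLinearMap)

/-- `a ⊗ b ↦ f(a) g(b)`, extended by continuity, with values in the completion of `A`. -/
def convolve (f g : A →ₗ[Ch] A) : T2 A →ₗ[Ch] Compl A :=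
  cmap (LinearMap.mul' Ch A ∘ₗ TensorProduct.map f g ∘ₗ
    (GradedTensorProduct.of Ch (deg A) (deg A)).symm.toLinearMap)

/-- The composition of the counit with the unit. -/
def unitCounit (ε : A →ₐ[Ch] Ch) : A →ₗ[Ch] A := Algebra.linearMap Ch A ∘ₗ ε.toLinearMap

/-- `A` is a topological Hopf superalgebra over `ℂ[[ħ]]` with comultiplication `Δ`, counit `ε` and
antipode `S`. Here `A` is identified with its completion along the bijection `toCompl`. -/
structure IsHopfSuperalgebra (Δ : A →ₐ[Ch] T2 A) (ε : A →ₐ[Ch] Ch) (S : A →ₗ[Ch] A) : Prop where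
  complete : IsAdicComplete hIdeal A
  comul_even : ∀ x, Δ (parity A x) = parity (T2 A) (Δ x)
  counit_even : ∀ x, ε (parity A x) = ε x
  antipode_even : ∀ x, S (parity A x) = parity A (S x)
  coassoc : ∀ x, coprodLeft Δ (Δ x) = coprodRight Δ (Δ x)
  counit_left : ∀ x, convolve (unitCounit ε) LinearMap.id (Δ x) = toCompl x
  counit_right : ∀ x, convolve LinearMap.id (unitCounit ε) (Δ x) = toCompl x
  antipode_left : ∀ x, convolve S LinearMap.id (Δ x) = toCompl (unitCounit ε x)
  antipode_right : ∀ x, convolve LinearMap.id S (Δ x) = toCompl (unitCounit ε x)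

/-- `R` is a universal `R`-matrix for `Δ`. -/
structure IsUniversalRMatrix (Δ : A →ₐ[Ch] T2 A) (R : T2 A) : Prop where
  invertible : IsUnit R
  intertwines : ∀ x, R * Δ x = flip (Δ x) * R
  comul_left : coprodLeft Δ R = leg13 R * leg23 R
  comul_right : coprodRight Δ R = leg13 R * leg12 R

end Hopf

/-! ### The quantum enveloping superalgebra of `gl(1|1)` -/

/-- The generators. -/
inductive Gen : Type
  | E | F | H1 | H2

/-- The free algebra on the generators. -/
abbrev FreeAlg : Type := FreeAlgebra Ch Gen

/-- The sign `(-1)^|g|` of a generator. -/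
def Gen.sign : Gen → Ch
  | .E => -1
  | .F => -1
  | .H1 => 1
  | .H2 => 1

/-- `E` and `F` are odd, `H1` and `H2` are even. -/
instance : Superalgebra FreeAlg where
  parity := FreeAlgebra.lift Ch fun g => g.sign • FreeAlgebra.ι Ch g
  parity_parity := by
    intro x
    rw [← AlgHom.comp_apply]
    conv_rhs => rw [← AlgHom.id_apply (R := Ch) x]
    congr 1
    ext g
    cases g <;> simp [Gen.sign, smul_smul]

/-- A generator as an element of the completed free algebra. -/
def gen (g : Gen) : Compl FreeAlg := toCompl (FreeAlgebra.ι Ch g)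

/-- The defining relations, in the completed free algebra. -/
inductive Rel : Compl FreeAlg → Compl FreeAlg → Prop
  | HH : Rel (gen .H1 * gen .H2) (gen .H2 * gen .H1)
  | H1E : Rel (gen .H1 * gen .E - gen .E * gen .H1) (gen .E)
  | H2E : Rel (gen .H2 * gen .E - gen .E * gen .H2) (-gen .E)
  | H1F : Rel (gen .H1 * gen .F - gen .F * gen .H1) (-gen .F)
  | H2F : Rel (gen .H2 * gen .F - gen .F * gen .H2) (gen .F)
  | EF : Rel (gen .E * gen .F + gen .F * gen .E) (bracket (gen .H1 + gen .H2))
  | EE : Rel (gen .E * gen .E) 0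
  | FF : Rel (gen .F * gen .F) 0

/-- The quotient of the completed free algebra by the two-sided ideal generated by the
relations. -/
abbrev PreU : Type := RingQuot Rel

theorem parity_gen (g : Gen) : parity (Compl FreeAlg) (gen g) = g.sign • gen g :=
  Compl.ext fun n => by
    refine (comp_cmap (parity FreeAlg).toLinearMap n (gen g) _ (comp_toCompl n _)).trans ?_
    rw [map_smul, gen, comp_toCompl, ← Submodule.Quotient.mk_smul]
    simp [parity, Superalgebra.parity]

instance : Superalgebra PreU where
  parity := RingQuot.liftAlgHom Ch ⟨(RingQuot.mkAlgHom Ch Rel).comp (parity (Compl FreeAlg)), by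
    intro x y h
    have hb : parity (Compl FreeAlg) (bracket (gen .H1 + gen .H2))
        = bracket (gen .H1 + gen .H2) := by
      refine (cmapAlg_bracket (parity FreeAlg) _).trans ?_
      congr 1
      change parity (Compl FreeAlg) _ = _
      simp [parity_gen, Gen.sign]
    have hr := RingQuot.mkAlgHom_rel Ch h
    cases h <;> simp only [AlgHom.comp_apply, map_mul, map_sub, map_add, map_neg, map_zero,
      parity_gen, hb, Gen.sign, one_smul, neg_smul, mul_neg, neg_mul, neg_neg] at hr ⊢
    case HH => exact hr
    case H1E => rw [← neg_inj] at hr; rw [← hr]; abel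
    case H2E => have h2 := congrArg Neg.neg hr; rw [neg_neg] at h2; refine Eq.trans ?_ h2; abel
    case H1F => have h2 := congrArg Neg.neg hr; rw [neg_neg] at h2; refine Eq.trans ?_ h2; abel
    case H2F => rw [← neg_inj] at hr; rw [← hr]; abel
    case EF => exact hr
    case EE => exact hr
    case FF => exact hr⟩
  parity_parity := by
    intro x
    rw [← AlgHom.comp_apply]
    conv_rhs => rw [← AlgHom.id_apply (R := Ch) x]
    congr 1
    refine RingQuot.ringQuot_ext' Ch _ _ (AlgHom.ext fun y => ?_)
    simp [Superalgebra.parity_parity]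

/-- The superalgebra `U_ħ(gl(1|1))`, topologically generated by `E, F, H1, H2` subject to the
relations `Rel`: the quotient of the completed free algebra by the `ħ`-adic closure of the
two-sided ideal generated by the relations, obtained as the completion of `PreU`. -/
abbrev U : Type := Compl PreU

namespace U

/-- The generators of `U_ħ(gl(1|1))`. -/
def ofGen (g : Gen) : U := toCompl (RingQuot.mkAlgHom Ch Rel (gen g))

/-- The generator `E`. -/
def E : U := ofGen .E

/-- The generator `F`. -/
def F : U := ofGen .F

/-- The generator `H_1`. -/
def H1 : U := ofGen .H1

/-- The generator `H_2`. -/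
def H2 : U := ofGen .H2

/-- `K = e^(ħ (H_1 + H_2))`. -/
def K : U := hExp (H1 + H2)

/-- `K⁻¹ = e^(-ħ (H_1 + H_2))`. -/
def Kinv : U := hExp (-(H1 + H2))

/-- The values of the comultiplication, the counit and the antipode on the generators; `Δ` and `ε`
are algebra homomorphisms and `S` is a (super) anti-homomorphism. -/
structure IsStructureMaps (Δ : U →ₐ[Ch] T2 U) (ε : U →ₐ[Ch] Ch) (S : U →ₗ[Ch] U) : Prop where
  comul_E : Δ E = tens E Kinv + tens 1 E
  comul_F : Δ F = tens F 1 + tens K F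
  comul_H1 : Δ H1 = tens H1 1 + tens 1 H1
  comul_H2 : Δ H2 = tens H2 1 + tens 1 H2
  counit_E : ε E = 0
  counit_F : ε F = 0
  counit_H1 : ε H1 = 0
  counit_H2 : ε H2 = 0
  antipode_E : S E = -(E * K)
  antipode_F : S F = -(Kinv * F)
  antipode_H1 : S H1 = -H1
  antipode_H2 : S H2 = -H2
  antipode_one : S 1 = 1
  antipode_mul : ∀ (i j : ZMod 2) (x y : U), x ∈ deg U i → y ∈ deg U j →
    S (x * y) = (-1 : ℤˣ) ^ (i * j) • (S y * S x)

/-- `Υ = e^(ħ (H_1 ⊗ H_1 - H_2 ⊗ H_2))`. -/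
def Upsilon : T2 U := hExp (tens H1 H1 - tens H2 H2)

/-- `Θ = 1 + (q - q⁻¹) F ⊗ E`. -/
def Theta : T2 U := 1 + (q - q⁻¹) • tens F E

/-- `R = Θ Υ`. -/
def R : T2 U := Theta * Upsilon

end U

end SuperHopf

end

noncomputable section

namespace SuperHopf

open TensorProduct

/-! ### Linear maps between completions -/

section Completion

variable {A B C : Type} [Ring A] [Algebra Ch A] [Ring B] [Algebra Ch B] [Ring C] [Algebra Ch C]

/-! The argument rests on universal properties and never uses a PBW basis or the absence of
`ħ`-torsion. A `ℂ[[ħ]]`-linear map of completions is automatically continuous, so it is determined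
on a dense subset. Hence a homomorphism out of `U` is the same as a quadruple satisfying the
relations (`lift`, `algHom_ext`), and homomorphisms out of a completed tensor product come from
pairs of supercommuting homomorphisms (`slift`). The linear maps `Δ ⊗ id`, `id ⊗ Δ`, `ε ⊗ id`, `id ⊗
ε`, the flip and the leg embeddings all turn out to be algebra homomorphisms, so most identities
need checking only on generators.

The comultiplication exists because of the addition formula `[a + b] = [a] e^(-ħb) + e^(ħa) [b]` for
commuting `a`, `b` (`bracket_add`). It is proved for power series in a formal variable, where
division by the variable is harmless, and then specialised to `ħ`. The antipode is not a
homomorphism, but multiplying its odd values by `√-1` makes it an ordinary anti-homomorphism, that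
is, a homomorphism to the opposite algebra; this yields both existence and uniqueness. For the
antipode axioms, `m (S ⊗ id)` applied to a product `u v` pulls out the value at `u` as soon as that
value is a scalar, so the axioms propagate from generators to products
(`convolve_antipode_left_mul`, `convolve_antipode_right_mul`).

For the `R`-matrix, `E` and `F` are weight vectors, so moving one of them past `Υ` creates a power
of `K` in the other tensor factor. Conjugation by `Υ` therefore brings `Δ(E)` and `Δ(F)` to their
opposites up to exchanging `K` and `K⁻¹`. The factor `Θ` repairs this by `(q - q⁻¹)(EF + FE) = K -
K⁻¹`. In the hexagon identities the exponent of `Υ` is additive because the `H_i` are primitive.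
Moving `Υ₁₃` past the second `Θ` produces exactly the `K` or `K⁻¹` occurring in `Δ(F)` or `Δ(E)`,
and the quadratic term dies because `E² = F² = 0`. -/

theorem hIdeal_fg : hIdeal.FG := ⟨{hbar}, by simp⟩

instance : IsAdicComplete hIdeal (Compl A) := AdicCompletion.isAdicComplete hIdeal_fg

theorem comp_eq_zero_of_mem (n : ℕ) {x : Compl A}
    (hx : x ∈ (hIdeal ^ n • ⊤ : Submodule Ch (Compl A))) :
    comp n x = 0 :=
  AdicCompletion.pow_smul_top_le_ker_eval (I := hIdeal) (M := A) n hx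

/-- Finite generation of `(ħ)` enters here: it makes the inverse limit topology of the completion
agree with its own `ħ`-adic topology, which every linear map respects. -/
theorem mem_of_comp_eq_zero (n : ℕ) {x : Compl A} (hx : comp n x = 0) :
    x ∈ (hIdeal ^ n • ⊤ : Submodule Ch (Compl A)) := by
  have h := AdicCompletion.pow_smul_top_eq_ker_eval (I := hIdeal) (M := A) (n := n) hIdeal_fg
  exact h.ge hx

/-- Linear maps between completions are continuous, so they are determined on a dense subset. -/
theorem Compl.linearMap_ext {f g : Compl A →ₗ[Ch] Compl B}
    (h : ∀ a, f (toCompl a) = g (toCompl a)) : f = g := by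
  refine LinearMap.ext fun x => Compl.ext fun n => ?_
  obtain ⟨a, ha⟩ := Submodule.Quotient.mk_surjective _ (comp n x)
  have hx : x - toCompl a ∈ (hIdeal ^ n • ⊤ : Submodule Ch (Compl A)) :=
    mem_of_comp_eq_zero n (by rw [map_sub, ← ha, comp_toCompl, sub_self])
  have key : ∀ f : Compl A →ₗ[Ch] Compl B, comp n (f x) = comp n (f (toCompl a)) := fun f => by
    rw [← sub_eq_zero, ← map_sub, ← map_sub]
    exact comp_eq_zero_of_mem n (Submodule.smul_top_le_comap_smul_top (hIdeal ^ n) f hx)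
  rw [key f, key g, h a]

theorem extend_toCompl (f : A →ₗ[Ch] Compl B) (a : A) : extend f (toCompl a) = f a :=
  Compl.ext fun n => comp_extend f n _ a (comp_toCompl n a)

theorem cmap_toCompl (f : A →ₗ[Ch] B) (a : A) : cmap f (toCompl a) = toCompl (f a) :=
  extend_toCompl _ a

theorem toCompl_mul (a b : A) : toCompl (a * b) = toCompl a * toCompl b :=
  Compl.ext fun n => by rw [comp_mul, comp_toCompl, comp_toCompl, comp_toCompl, quotMul_mk]

variable (A) in
/-- The canonical map to the completion as an algebra homomorphism. -/
def toComplAlg : A →ₐ[Ch] Compl A :=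
  AlgHom.ofLinearMap toCompl rfl toCompl_mul

@[simp] theorem toComplAlg_apply (a : A) : toComplAlg A a = toCompl a := rfl

/-- The extension by continuity of an algebra homomorphism. -/
def extendAlg (f : A →ₐ[Ch] Compl B) : Compl A →ₐ[Ch] Compl B :=
  AlgHom.ofLinearMap (extend f.toLinearMap)
    ((extend_toCompl f.toLinearMap 1).trans (map_one f))
    (fun x y => Compl.ext fun n => by
      obtain ⟨a, ha⟩ := Submodule.Quotient.mk_surjective _ (comp n x)
      obtain ⟨b, hb⟩ := Submodule.Quotient.mk_surjective _ (comp n y)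
      rw [comp_extend _ n (x * y) (a * b) (by rw [comp_mul, ← ha, ← hb, quotMul_mk]), comp_mul,
        comp_extend _ n x a ha.symm, comp_extend _ n y b hb.symm, ← comp_mul]
      simp)

@[simp] theorem extendAlg_toCompl (f : A →ₐ[Ch] Compl B) (a : A) :
    extendAlg f (toCompl a) = f a := extend_toCompl _ a

@[simp] theorem cmapAlg_toCompl (f : A →ₐ[Ch] B) (a : A) :
    cmapAlg f (toCompl a) = toCompl (f a) := cmap_toCompl _ a

/-- A complete algebra is isomorphic to its completion. -/
def complEquiv (A : Type) [Ring A] [Algebra Ch A] [IsAdicComplete hIdeal A] : A ≃ₐ[Ch] Compl A :=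
  AlgEquiv.ofBijective (toComplAlg A) (AdicCompletion.of_bijective hIdeal A)

@[simp] theorem complEquiv_symm_toCompl [IsAdicComplete hIdeal A] (a : A) :
    (complEquiv A).symm (toCompl a) = a := (complEquiv A).symm_apply_apply a

theorem toCompl_injective [IsAdicComplete hIdeal A] :
    Function.Injective (toCompl : A →ₗ[Ch] Compl A) := (complEquiv A).injective

/-! ### Sums of powers of `ħ` -/

theorem map_hSum (f : Compl A →ₗ[Ch] Compl B) (g : ℕ → Compl A) :
    f (hSum g) = hSum fun m => f (g m) := by
  -- By continuity `f` is the extension of its restriction to the dense image of `A`, so it can be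
  -- computed modulo each `ħ^n`, where the sum is finite.
  have hf : f = extend (f ∘ₗ toCompl) := Compl.linearMap_ext fun a => by
    rw [extend_toCompl]; rfl
  refine Compl.ext fun n => ?_
  rw [hf, comp_extend', comp_hSum, comp_hSum, map_sum]
  simp only [map_smul, comp_extend']

theorem hSum_add (f g : ℕ → Compl A) : hSum (f + g) = hSum f + hSum g :=
  Compl.ext fun n => by
    rw [map_add]
    simp only [comp_hSum, Pi.add_apply, map_add, smul_add, Finset.sum_add_distrib]

/-- Modulo `ħ^n` the left side is a sum over the square `i, j < n` and the right side a sum over the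
triangle `i + j < n`; the pairs in between carry a factor `ħ^n`. -/
theorem hSum_mul (f g : ℕ → Compl A) :
    hSum f * hSum g = hSum fun m => ∑ p ∈ Finset.HasAntidiagonal.antidiagonal m, f p.1 * g p.2 := by
  refine Compl.ext fun n => ?_
  rw [comp_mul]
  simp only [comp_hSum, map_sum, LinearMap.sum_apply, map_smul, LinearMap.smul_apply,
    Finset.smul_sum, ← comp_mul, smul_smul, ← pow_add]
  rw [Finset.sum_comm, ← Finset.sum_product', Finset.sum_sigma']
  symm
  refine Finset.sum_of_injOn (fun p => p.2) ?_ ?_ ?_ ?_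
  · rintro ⟨m, p⟩ hp ⟨m', p'⟩ hp' h
    simp only [Finset.coe_sigma, Set.mem_sigma_iff, Finset.mem_coe,
      Finset.HasAntidiagonal.mem_antidiagonal] at hp hp'
    simp only at h
    obtain rfl : m = m' := by rw [← hp.2, ← hp'.2, h]
    rw [h]
  · rintro ⟨m, p⟩ hp
    simp only [Finset.coe_sigma, Set.mem_sigma_iff, Finset.mem_coe,
      Finset.HasAntidiagonal.mem_antidiagonal,
      Finset.mem_range, Finset.mem_product] at hp ⊢
    omega
  · rintro ⟨i, j⟩ _ h
    have hn : n ≤ i + j := by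
      by_contra hlt
      exact h ⟨⟨i + j, (i, j)⟩, by simpa using hlt, rfl⟩
    have e : i + j = (i + j - n) + n := by omega
    simp only
    rw [add_comm j i, e, pow_add, mul_smul, hbar_pow_smul_quot, smul_zero]
  · rintro ⟨m, p⟩ hp
    simp only [Finset.mem_sigma, Finset.HasAntidiagonal.mem_antidiagonal] at hp
    rw [← hp.2, add_comm p.2]

variable (A) in
/-- The substitution of `ħ` for the variable of a power series with coefficients in a completion. -/
def evalHbar : PowerSeries (Compl A) →+* Compl A where
  toFun p := hSum fun m => PowerSeries.coeff m p
  map_one' := Compl.ext fun n => by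
    rw [comp_hSum, comp_one]
    rcases n with _ | n
    · rw [Finset.range_zero, Finset.sum_empty]
      -- The quotient by `ħ^0` is zero, so there `1` does equal the empty sum.
      exact (hbar_pow_smul_quot 0 _).symm.trans (one_smul Ch _)
    · rw [Finset.sum_eq_single 0]
      · simp [comp_one]
      · intro b _ hb
        simp [PowerSeries.coeff_one, hb]
      · simp
  map_mul' p p' := by simp only [hSum_mul, PowerSeries.coeff_mul]
  map_zero' := Compl.ext fun n => by simp [comp_hSum]
  map_add' p p' := by
    rw [← hSum_add]; congr 1

theorem evalHbar_mk (f : ℕ → Compl A) : evalHbar A (PowerSeries.mk f) = hSum f := by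
  simp [evalHbar]

/-- The power series `e^(a X)`. -/
def expSeries (a : Compl A) : PowerSeries (Compl A) :=
  PowerSeries.mk fun m => (PowerSeries.C ((m.factorial : ℂ)⁻¹) : Ch) • a ^ m

/-- The power series `(e^(a X) - e^(-a X)) / X`. -/
def sinhSeries (a : Compl A) : PowerSeries (Compl A) :=
  PowerSeries.mk fun m =>
    (PowerSeries.C ((1 - (-1) ^ (m + 1)) / ((m + 1).factorial : ℂ)) : Ch) • a ^ (m + 1)

theorem evalHbar_expSeries (a : Compl A) : evalHbar A (expSeries a) = hExp a := evalHbar_mk _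

theorem bracket_eq (a : Compl A) : bracket a = qDiff⁻¹ • evalHbar A (sinhSeries a) := by
  rw [sinhSeries, evalHbar_mk]; rfl

theorem neg_pow_smul (a : Compl A) (m : ℕ) :
    (-a) ^ m = (PowerSeries.C ((-1 : ℂ) ^ m) : Ch) • a ^ m := by
  rcases Nat.even_or_odd m with h | h
  · rw [h.neg_pow, h.neg_one_pow, map_one, one_smul]
  · rw [h.neg_pow, h.neg_one_pow, map_neg, map_one, neg_smul, one_smul]

theorem X_mul_sinhSeries (a : Compl A) :
    PowerSeries.X * sinhSeries a = expSeries a - expSeries (-a) := by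
  ext m
  rcases m with _ | m
  · simp [expSeries]
  · rw [PowerSeries.coeff_succ_X_mul, map_sub]
    simp only [sinhSeries, expSeries, PowerSeries.coeff_mk]
    rw [neg_pow_smul, smul_smul, ← sub_smul, ← map_mul, ← map_sub]
    congr 2
    ring

theorem expSeries_add {a b : Compl A} (h : Commute a b) :
    expSeries (a + b) = expSeries a * expSeries b := by
  ext m
  rw [PowerSeries.coeff_mul]
  simp only [expSeries, PowerSeries.coeff_mk, h.add_pow', Finset.smul_sum]
  refine Finset.sum_congr rfl fun p hp => ?_
  obtain rfl := Finset.HasAntidiagonal.mem_antidiagonal.1 hp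
  rw [smul_mul_smul_comm, ← Nat.cast_smul_eq_nsmul Ch, smul_smul]
  congr 1
  rw [← map_natCast (PowerSeries.C (R := ℂ)), ← map_mul, ← map_mul]
  congr 1
  rw [Nat.cast_add_choose]
  have h1 := Nat.cast_ne_zero (R := ℂ).2 (Nat.factorial_ne_zero (p.1 + p.2))
  field_simp

/-- After multiplication by the variable this is the telescoping identity `e^(a+b) - e^(-a-b) = (e^a
- e^(-a)) e^(-b) + e^a (e^b - e^(-b))`. The variable can be cancelled in a power series ring,
whereas `ħ` may be a zero divisor on the completion; hence the detour through power series. -/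
theorem sinhSeries_add {a b : Compl A} (h : Commute a b) :
    sinhSeries (a + b) = sinhSeries a * expSeries (-b) + expSeries a * sinhSeries b := by
  have hX : PowerSeries.X * sinhSeries (a + b)
      = PowerSeries.X * (sinhSeries a * expSeries (-b) + expSeries a * sinhSeries b) := by
    rw [mul_add, ← mul_assoc, ← mul_assoc, (PowerSeries.commute_X (expSeries a)).symm.eq,
      mul_assoc (expSeries a),
      X_mul_sinhSeries, X_mul_sinhSeries, X_mul_sinhSeries, neg_add, expSeries_add h,
      expSeries_add h.neg_left.neg_right]
    noncomm_ring
  ext m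
  have := congrArg (PowerSeries.coeff (m + 1)) hX
  rwa [PowerSeries.coeff_succ_X_mul, PowerSeries.coeff_succ_X_mul] at this

/-! ### The exponential and the quantum bracket -/

theorem map_hExp (f : Compl A →ₐ[Ch] Compl B) (a : Compl A) : f (hExp a) = hExp (f a) := by
  refine (map_hSum f.toLinearMap _).trans ?_
  simp [hExp]

theorem map_bracket (f : Compl A →ₐ[Ch] Compl B) (a : Compl A) :
    f (bracket a) = bracket (f a) := by
  rw [bracket, map_smul]
  refine congrArg _ ((map_hSum f.toLinearMap _).trans ?_)
  simp

theorem hExp_zero : hExp (0 : Compl A) = 1 := by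
  rw [← evalHbar_expSeries, ← map_one (evalHbar A)]
  congr 1
  ext m
  rcases m with _ | m <;> simp [expSeries, PowerSeries.coeff_one]

theorem hExp_add {a b : Compl A} (h : Commute a b) : hExp (a + b) = hExp a * hExp b := by
  simp only [← evalHbar_expSeries, expSeries_add h, map_mul]

theorem hExp_mul_hExp_neg (a : Compl A) : hExp a * hExp (-a) = 1 := by
  rw [← hExp_add (Commute.refl a).neg_right, add_neg_cancel, hExp_zero]

theorem hExp_neg_mul_hExp (a : Compl A) : hExp (-a) * hExp a = 1 := by
  rw [← hExp_add (Commute.refl a).neg_left, neg_add_cancel, hExp_zero]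

theorem isUnit_hExp (a : Compl A) : IsUnit (hExp a) :=
  ⟨⟨_, _, hExp_mul_hExp_neg a, hExp_neg_mul_hExp a⟩, rfl⟩

/-- With `a` and `b` the two copies of `H_1 + H_2` in a tensor square, this is the compatibility of
`Δ` with the relation for `EF + FE`. -/
theorem bracket_add {a b : Compl A} (h : Commute a b) :
    bracket (a + b) = bracket a * hExp (-b) + hExp a * bracket b := by
  simp only [bracket_eq, ← evalHbar_expSeries, sinhSeries_add h, map_add, map_mul, smul_add,
    smul_mul_assoc, mul_smul_comm]

theorem bracket_zero : bracket (0 : Compl A) = 0 := by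
  rw [bracket_eq, sinhSeries]
  have : (PowerSeries.mk fun m => (PowerSeries.C ((1 - (-1) ^ (m + 1)) /
      ((m + 1).factorial : ℂ)) : Ch) • (0 : Compl A) ^ (m + 1)) = 0 := by
    ext m; simp
  rw [this, map_zero, smul_zero]

theorem bracket_neg (a : Compl A) : bracket (-a) = -bracket a := by
  have : sinhSeries (-a) = -sinhSeries a := by
    ext m
    have := congrArg (PowerSeries.coeff (m + 1)) (X_mul_sinhSeries a)
    have h' := congrArg (PowerSeries.coeff (m + 1)) (X_mul_sinhSeries (-a))
    rw [PowerSeries.coeff_succ_X_mul] at this h'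
    rw [h', map_neg, this, ← map_neg, neg_sub, neg_neg]
  rw [bracket_eq, this, map_neg, smul_neg, bracket_eq]

/-- Left and right multiplication by `x` are linear, hence continuous, and may be taken inside the
sum. -/
theorem mul_hSum_eq_hSum_mul {x : Compl A} {f g : ℕ → Compl A}
    (h : ∀ m, x * f m = g m * x) : x * hSum f = hSum g * x := by
  have h1 := map_hSum (LinearMap.mulLeft Ch x) f
  have h2 := map_hSum (LinearMap.mulRight Ch x) g
  simp only [LinearMap.mulLeft_apply, LinearMap.mulRight_apply] at h1 h2
  rw [h1, h2]
  congr 1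
  exact funext h

theorem _root_.SemiconjBy.hExp {x a b : Compl A} (h : SemiconjBy x a b) :
    SemiconjBy x (hExp a) (hExp b) :=
  mul_hSum_eq_hSum_mul fun m => by
    rw [mul_smul_comm, smul_mul_assoc, (h.pow_right m).eq]

theorem _root_.Commute.hExp_right {x a : Compl A} (h : Commute x a) : Commute x (hExp a) :=
  SemiconjBy.hExp h

theorem _root_.Commute.hExp_left {x a : Compl A} (h : Commute a x) : Commute (hExp a) x :=
  h.symm.hExp_right.symm

/-- If `[a, x] = x c` with `c` commuting with `a`, then `e^(ħ a) x = x e^(ħ c) e^(ħ a)`. -/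
theorem hExp_mul_of_comm {a x c : Compl A} (h : a * x = x * (c + a)) (hc : Commute c a) :
    hExp a * x = x * hExp c * hExp a := by
  have : SemiconjBy x (c + a) a := h.symm
  rw [mul_assoc, ← hExp_add hc, this.hExp.eq]

end Completion

/-! ### Supercommuting homomorphisms -/

section Super

variable {A B C D : Type} [Ring A] [Algebra Ch A] [Superalgebra A] [Ring B] [Algebra Ch B]
  [Superalgebra B] [Ring C] [Algebra Ch C] [Ring D] [Algebra Ch D]

/-- Every element is the sum of an even and an odd one. -/
theorem exists_even_odd (x : A) : ∃ y z : A, parity A y = y ∧ parity A z = -z ∧ x = y + z := by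
  refine ⟨PowerSeries.C (1 / 2 : ℂ) • (x + parity A x), PowerSeries.C (1 / 2 : ℂ) • (x - parity A x),
    ?_, ?_, ?_⟩
  · rw [map_smul, map_add, Superalgebra.parity_parity, add_comm]
  · rw [map_smul, map_sub, Superalgebra.parity_parity, ← smul_neg, neg_sub]
  · rw [← smul_add, add_add_sub_cancel, smul_add, ← add_smul, two_half, one_smul]

/-- Two homomorphisms with `f(a) g(b) = (-1)^(|a||b|) g(b) f(a)`. -/
structure SuperCommute (f : A →ₐ[Ch] C) (g : B →ₐ[Ch] C) : Prop where
  even : ∀ a b, parity B b = b → f a * g b = g b * f a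
  odd : ∀ a b, parity B b = -b → f a * g b = g b * f (parity A a)

namespace SuperCommute

variable {f : A →ₐ[Ch] C} {g : B →ₐ[Ch] C}

/-- The definition fixes the parity of the second argument only; splitting the other argument into
even and odd parts shows that the condition is symmetric. -/
theorem symm (h : SuperCommute f g) : SuperCommute g f where
  even b a ha := by
    obtain ⟨y, z, hy, hz, rfl⟩ := exists_even_odd b
    rw [map_add, mul_add, add_mul, h.even a y hy, h.odd a z hz, ha]
  odd b a ha := by
    obtain ⟨y, z, hy, hz, rfl⟩ := exists_even_odd b
    simp only [map_add, hy, hz, mul_add, add_mul, h.even a y hy, map_neg, mul_neg, h.odd a z hz, ha,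
      neg_neg]

theorem comp_left {A' : Type} [Ring A'] [Algebra Ch A'] [Superalgebra A'] (h : SuperCommute f g)
    (φ : A' →ₐ[Ch] A) (hφ : ∀ x, φ (parity A' x) = parity A (φ x)) :
    SuperCommute (f.comp φ) g where
  even a b hb := h.even (φ a) b hb
  odd a b hb := by
    rw [AlgHom.comp_apply, AlgHom.comp_apply, hφ]; exact h.odd (φ a) b hb

theorem comp_right {B' : Type} [Ring B'] [Algebra Ch B'] [Superalgebra B'] (h : SuperCommute f g)
    (φ : B' →ₐ[Ch] B) (hφ : ∀ x, φ (parity B' x) = parity B (φ x)) :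
    SuperCommute f (g.comp φ) :=
  (h.symm.comp_left φ hφ).symm

theorem map (h : SuperCommute f g) (ψ : C →ₐ[Ch] D) : SuperCommute (ψ.comp f) (ψ.comp g) where
  even a b hb := by
    simp only [AlgHom.comp_apply, ← map_mul, h.even a b hb]
  odd a b hb := by
    simp only [AlgHom.comp_apply, ← map_mul, h.odd a b hb]

/-- The form of the condition that `GradedTensorProduct.lift` expects. -/
theorem mul_eq_smul (h : SuperCommute f g) ⦃i j : ZMod 2⦄ (a : deg A i) (b : deg B j) :
    f a * g b = (-1 : ℤˣ) ^ (j * i) • (g b * f a) := by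
  obtain ⟨a, ha⟩ := a
  obtain ⟨b, hb⟩ := b
  simp only
  have key : ∀ k : ZMod 2, k = 0 ∨ k = 1 := by decide
  rcases key j with rfl | rfl
  · rw [h.even a b (mem_deg_zero.1 hb), zero_mul, uzpow_zero, one_smul]
  · rw [h.odd a b (mem_deg_one.1 hb)]
    rcases key i with rfl | rfl
    · rw [mem_deg_zero.1 ha, mul_zero, uzpow_zero, one_smul]
    · rw [mem_deg_one.1 ha, one_mul, uzpow_one, map_neg, mul_neg, Units.neg_smul, one_smul]

end SuperCommute

/-! ### Super tensor products -/

theorem parity_toCompl (a : A) : parity (Compl A) (toCompl a) = toCompl (parity A a) :=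
  cmap_toCompl _ a

theorem parity_stmul (a : A) (b : B) :
    parity (STensor A B) (stmul a b) = stmul (parity A a) (parity B b) := by
  refine (GradedTensorProduct.lift_tmul (deg A) (deg B) _ _ _ a b).trans ?_
  exact GradedTensorProduct.tmul_one_mul_one_tmul (deg A) (deg B) _ _

theorem stmul_mul_of_even (a : A) {b : B} (c : A) (d : B) (hb : parity B b = b) :
    (stmul a b * stmul c d : STensor A B) = stmul (a * c) (b * d) := by
  obtain ⟨y, z, hy, hz, rfl⟩ := exists_even_odd c
  have h1 := GradedTensorProduct.tmul_coe_mul_coe_tmul (deg A) (deg B) a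
    ⟨b, mem_deg_zero.2 hb⟩ ⟨y, mem_deg_zero.2 hy⟩ d
  have h2 := GradedTensorProduct.tmul_coe_mul_coe_tmul (deg A) (deg B) a
    ⟨b, mem_deg_zero.2 hb⟩ ⟨z, mem_deg_one.2 hz⟩ d
  simp only [zero_mul, uzpow_zero, one_smul] at h1 h2
  simp only [stmul, GradedTensorProduct.tmul] at *
  rw [add_tmul, map_add, mul_add, h1, h2, mul_add, add_tmul, map_add]

/-- For odd `b` the sign `(-1)^(|b||c|)` is the parity automorphism applied to `c`, so `c` need not
be homogeneous. -/
theorem stmul_mul_of_odd (a : A) {b : B} (c : A) (d : B) (hb : parity B b = -b) :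
    (stmul a b * stmul c d : STensor A B) = stmul (a * parity A c) (b * d) := by
  obtain ⟨y, z, hy, hz, rfl⟩ := exists_even_odd c
  have h1 := GradedTensorProduct.tmul_coe_mul_coe_tmul (deg A) (deg B) a
    ⟨b, mem_deg_one.2 hb⟩ ⟨y, mem_deg_zero.2 hy⟩ d
  have h2 := GradedTensorProduct.tmul_coe_mul_coe_tmul (deg A) (deg B) a
    ⟨b, mem_deg_one.2 hb⟩ ⟨z, mem_deg_one.2 hz⟩ d
  simp only [one_mul, uzpow_zero, uzpow_one, one_smul, Units.neg_smul] at h1 h2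
  simp only [stmul, GradedTensorProduct.tmul] at *
  rw [add_tmul, map_add, mul_add, h1, h2, map_add, hy, hz, mul_add, add_tmul, map_add, mul_neg,
    neg_tmul, map_neg]

theorem stmul_one_mul_one_stmul (a : A) (b : B) :
    (stmul a 1 * stmul 1 b : STensor A B) = stmul a b :=
  GradedTensorProduct.tmul_one_mul_one_tmul (deg A) (deg B) a b

variable (A B)

/-- `a ↦ a ⊗ 1`. -/
def sinl : A →ₐ[Ch] STensor A B := GradedTensorProduct.includeLeft (deg A) (deg B)

/-- `b ↦ 1 ⊗ b`. -/
def sinr : B →ₐ[Ch] STensor A B := GradedTensorProduct.includeRight (deg A) (deg B)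

variable {A B}

theorem sinl_apply (a : A) : sinl A B a = stmul a 1 := rfl

theorem sinr_apply (b : B) : sinr A B b = stmul 1 b := rfl

theorem sinl_mul_sinr (a : A) (b : B) : sinl A B a * sinr A B b = stmul a b :=
  stmul_one_mul_one_stmul a b

theorem superCommute_sinl_sinr : SuperCommute (sinl A B) (sinr A B) where
  even a b hb := by
    rw [sinl_mul_sinr, sinl_apply, sinr_apply, stmul_mul_of_even _ _ _ hb, one_mul, mul_one]
  odd a b hb := by
    rw [sinl_mul_sinr, sinl_apply, sinr_apply, stmul_mul_of_odd _ _ _ hb, one_mul, mul_one,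
      Superalgebra.parity_parity]

theorem sinl_parity (a : A) : sinl A B (parity A a) = parity (STensor A B) (sinl A B a) := by
  rw [sinl_apply, sinl_apply, parity_stmul, map_one]

theorem sinr_parity (b : B) : sinr A B (parity B b) = parity (STensor A B) (sinr A B b) := by
  rw [sinr_apply, sinr_apply, parity_stmul, map_one]

theorem STensor.linearMap_ext {M : Type} [AddCommGroup M] [Module Ch M]
    {f g : STensor A B →ₗ[Ch] M} (h : ∀ a b, f (stmul a b) = g (stmul a b)) : f = g :=
  GradedTensorProduct.hom_ext _ _ (TensorProduct.ext' h)

/-- Linear maps from a completed tensor product are determined on pure tensors. -/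
theorem Compl.linearMap_ext_stmul {f g : Compl (STensor A B) →ₗ[Ch] Compl C}
    (h : ∀ a b, f (toCompl (stmul a b)) = g (toCompl (stmul a b))) : f = g :=
  Compl.linearMap_ext fun x =>
    LinearMap.congr_fun (STensor.linearMap_ext (f := f ∘ₗ toCompl) (g := g ∘ₗ toCompl) h) x

/-- The homomorphism `a ⊗ b ↦ f(a) g(b)`, extended by continuity. -/
def slift (f : A →ₐ[Ch] Compl C) (g : B →ₐ[Ch] Compl C) (h : SuperCommute f g) :
    Compl (STensor A B) →ₐ[Ch] Compl C :=
  extendAlg (GradedTensorProduct.lift (deg A) (deg B) f g h.mul_eq_smul)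

theorem slift_stmul (f : A →ₐ[Ch] Compl C) (g : B →ₐ[Ch] Compl C) (h : SuperCommute f g) (a : A)
    (b : B) : slift f g h (toCompl (stmul a b)) = f a * g b :=
  extendAlg_toCompl _ _

/-- For fixed `b` both sides of the condition are linear in `a`, so density of `A` in its completion
suffices. -/
theorem SuperCommute.of_compl {f : Compl A →ₐ[Ch] Compl C} {g : B →ₐ[Ch] Compl C}
    (h : SuperCommute (f.comp (toComplAlg A)) g) : SuperCommute f g where
  even a b hb := by
    have := Compl.linearMap_ext (f := LinearMap.mulRight Ch (g b) ∘ₗ f.toLinearMap)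
      (g := LinearMap.mulLeft Ch (g b) ∘ₗ f.toLinearMap) fun a => h.even a b hb
    exact LinearMap.congr_fun this a
  odd a b hb := by
    have := Compl.linearMap_ext (f := LinearMap.mulRight Ch (g b) ∘ₗ f.toLinearMap)
      (g := LinearMap.mulLeft Ch (g b) ∘ₗ f.toLinearMap ∘ₗ (parity (Compl A)).toLinearMap)
      fun a => by
        have h' := h.odd a b hb
        simp only [AlgHom.comp_apply, toComplAlg_apply, ← parity_toCompl] at h'
        exact h'
    exact LinearMap.congr_fun this a

end Super

/-! ### The legs of a tensor product -/

section Legs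

variable (A : Type) [Ring A] [Algebra Ch A] [Superalgebra A]

/-- `a ↦ a ⊗ 1`. -/
def in1 : A →ₐ[Ch] T2 A := (toComplAlg _).comp (sinl A A)

/-- `a ↦ 1 ⊗ a`. -/
def in2 : A →ₐ[Ch] T2 A := (toComplAlg _).comp (sinr A A)

/-- `a ↦ a ⊗ 1 ⊗ 1`. -/
def leg1 : A →ₐ[Ch] T3 A := (toComplAlg _).comp ((sinl (STensor A A) A).comp (sinl A A))

/-- `a ↦ 1 ⊗ a ⊗ 1`. -/
def leg2 : A →ₐ[Ch] T3 A := (toComplAlg _).comp ((sinl (STensor A A) A).comp (sinr A A))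

/-- `a ↦ 1 ⊗ 1 ⊗ a`. -/
def leg3 : A →ₐ[Ch] T3 A := (toComplAlg _).comp (sinr (STensor A A) A)

theorem superCommute_in : SuperCommute (in1 A) (in2 A) := superCommute_sinl_sinr.map _

theorem superCommute_leg12 : SuperCommute (leg1 A) (leg2 A) :=
  (superCommute_sinl_sinr.map _).map _

theorem superCommute_leg13 : SuperCommute (leg1 A) (leg3 A) :=
  (superCommute_sinl_sinr.comp_left _ sinl_parity).map _

theorem superCommute_leg23 : SuperCommute (leg2 A) (leg3 A) :=
  (superCommute_sinl_sinr.comp_left _ sinr_parity).map _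

/-- The homomorphism `leg12`. -/
def leg12Alg : T2 A →ₐ[Ch] T3 A := cmapAlg (sinl (STensor A A) A)

/-- The homomorphism `leg13`. -/
def leg13Alg : T2 A →ₐ[Ch] T3 A := slift _ _ (superCommute_leg13 A)

/-- The homomorphism `leg23`. -/
def leg23Alg : T2 A →ₐ[Ch] T3 A := slift _ _ (superCommute_leg23 A)

variable {A}

theorem in1_mul_in2 (a b : A) : in1 A a * in2 A b = tens a b := by
  rw [in1, in2, AlgHom.comp_apply, AlgHom.comp_apply, ← map_mul, sinl_mul_sinr]; rfl

theorem leg12Alg_apply (x : T2 A) : leg12Alg A x = leg12 x := rfl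

theorem leg12_tens (a b : A) : leg12 (tens a b) = leg1 A a * leg2 A b := by
  rw [← leg12Alg_apply, ← in1_mul_in2, map_mul]
  simp only [leg12Alg, in1, in2, leg1, leg2, AlgHom.comp_apply, toComplAlg_apply, cmapAlg_toCompl]

theorem leg13Alg_apply (x : T2 A) : leg13Alg A x = leg13 x := by
  refine LinearMap.congr_fun (Compl.linearMap_ext_stmul
    (f := (leg13Alg A).toLinearMap) (g := leg13) fun a b => ?_) x
  refine (slift_stmul _ _ (superCommute_leg13 A) a b).trans ?_
  rw [leg13, cmap_toCompl, leg1, leg3, AlgHom.comp_apply, AlgHom.comp_apply, AlgHom.comp_apply,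
    ← map_mul, sinl_mul_sinr]
  rfl

theorem leg23Alg_apply (x : T2 A) : leg23Alg A x = leg23 x := by
  refine LinearMap.congr_fun (Compl.linearMap_ext_stmul
    (f := (leg23Alg A).toLinearMap) (g := leg23) fun a b => ?_) x
  refine (slift_stmul _ _ (superCommute_leg23 A) a b).trans ?_
  rw [leg23, cmap_toCompl, leg2, leg3, AlgHom.comp_apply, AlgHom.comp_apply, AlgHom.comp_apply,
    ← map_mul, sinl_mul_sinr]
  rfl

theorem leg13_tens (a b : A) : leg13 (tens a b) = leg1 A a * leg3 A b := by
  rw [← leg13Alg_apply]; exact slift_stmul _ _ _ a b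

theorem leg23_tens (a b : A) : leg23 (tens a b) = leg2 A a * leg3 A b := by
  rw [← leg23Alg_apply]; exact slift_stmul _ _ _ a b

theorem parity_tens (a b : A) : parity (T2 A) (tens a b) = tens (parity A a) (parity A b) := by
  rw [tens, parity_toCompl, parity_stmul]; rfl

theorem superCommute_leg12_leg3 : SuperCommute (leg12Alg A) (leg3 A) := by
  refine SuperCommute.of_compl ?_
  have : (leg12Alg A).comp (toComplAlg _) = (toComplAlg _).comp (sinl (STensor A A) A) :=
    AlgHom.ext fun x => cmapAlg_toCompl _ x
  rw [this]
  exact superCommute_sinl_sinr.map _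

/-- An odd element of the first leg passes `c` in the third leg and then `b` in the second, applying
the parity automorphism to each; together this is the parity of `b ⊗ c`. With an even `Δ` it makes
`id ⊗ Δ` a homomorphism. -/
theorem superCommute_leg1_leg23 : SuperCommute (leg1 A) (leg23Alg A) := by
  refine (SuperCommute.of_compl (SuperCommute.symm ?_)).symm
  have key : ∀ b c : A, (leg23Alg A).comp (toComplAlg _) (stmul b c) = leg2 A b * leg3 A c :=
    fun b c => slift_stmul _ _ (superCommute_leg23 A) b c
  refine SuperCommute.symm ⟨?_, ?_⟩
  · intro x a ha
    refine LinearMap.congr_fun (STensor.linearMap_ext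
      (f := LinearMap.mulRight Ch (leg1 A a) ∘ₗ ((leg23Alg A).comp (toComplAlg _)).toLinearMap)
      (g := LinearMap.mulLeft Ch (leg1 A a) ∘ₗ ((leg23Alg A).comp (toComplAlg _)).toLinearMap)
      fun b c => ?_) x
    simp only [LinearMap.comp_apply, LinearMap.mulRight_apply, LinearMap.mulLeft_apply,
      AlgHom.toLinearMap_apply, key]
    rw [mul_assoc, (superCommute_leg13 A).symm.even _ _ ha, ← mul_assoc,
      (superCommute_leg12 A).symm.even _ _ ha, mul_assoc]
  · intro x a ha
    refine LinearMap.congr_fun (STensor.linearMap_ext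
      (f := LinearMap.mulRight Ch (leg1 A a) ∘ₗ ((leg23Alg A).comp (toComplAlg _)).toLinearMap)
      (g := LinearMap.mulLeft Ch (leg1 A a) ∘ₗ ((leg23Alg A).comp (toComplAlg _)).toLinearMap ∘ₗ
        (parity (STensor A A)).toLinearMap)
      fun b c => ?_) x
    simp only [LinearMap.comp_apply, LinearMap.mulRight_apply, LinearMap.mulLeft_apply,
      AlgHom.toLinearMap_apply, parity_stmul, key]
    rw [mul_assoc, (superCommute_leg13 A).symm.odd _ _ ha, ← mul_assoc,
      (superCommute_leg12 A).symm.odd _ _ ha, mul_assoc]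

variable (Δ : A →ₐ[Ch] T2 A) (hΔ : ∀ x, Δ (parity A x) = parity (T2 A) (Δ x))

/-- The homomorphism `Δ ⊗ id`. -/
def coprodLeftAlg : T2 A →ₐ[Ch] T3 A :=
  slift ((leg12Alg A).comp Δ) (leg3 A) (superCommute_leg12_leg3.comp_left Δ hΔ)

/-- The homomorphism `id ⊗ Δ`. -/
def coprodRightAlg : T2 A →ₐ[Ch] T3 A :=
  slift (leg1 A) ((leg23Alg A).comp Δ) (superCommute_leg1_leg23.comp_right Δ hΔ)

/-- `coprodLeft` is built as a linear map only; knowing that it is multiplicative reduces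
coassociativity and the hexagon identity to generators. -/
theorem coprodLeftAlg_apply (x : T2 A) : coprodLeftAlg Δ hΔ x = coprodLeft Δ x := by
  refine LinearMap.congr_fun (Compl.linearMap_ext_stmul
    (f := (coprodLeftAlg Δ hΔ).toLinearMap) (g := coprodLeft Δ) fun a b => ?_) x
  refine (slift_stmul _ _ (superCommute_leg12_leg3.comp_left Δ hΔ) a b).trans ?_
  rw [coprodLeft, extend_toCompl]
  change leg12Alg A (Δ a) * leg3 A b = cmap (appendRight b) (Δ a)
  refine LinearMap.congr_fun (Compl.linearMap_ext (f := LinearMap.mulRight Ch (leg3 A b) ∘ₗ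
    (leg12Alg A).toLinearMap) (g := cmap (appendRight b)) fun y => ?_) (Δ a)
  rw [cmap_toCompl]
  simp only [LinearMap.comp_apply, LinearMap.mulRight_apply, AlgHom.toLinearMap_apply, leg12Alg,
    cmapAlg_toCompl, leg3, AlgHom.comp_apply, toComplAlg_apply, ← toCompl_mul, sinl_mul_sinr]
  rfl

theorem coprodRightAlg_apply (x : T2 A) : coprodRightAlg Δ hΔ x = coprodRight Δ x := by
  refine LinearMap.congr_fun (Compl.linearMap_ext_stmul
    (f := (coprodRightAlg Δ hΔ).toLinearMap) (g := coprodRight Δ) fun a b => ?_) x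
  refine (slift_stmul _ _ (superCommute_leg1_leg23.comp_right Δ hΔ) a b).trans ?_
  rw [coprodRight, extend_toCompl]
  change leg1 A a * leg23Alg A (Δ b) = cmap (appendLeft a) (Δ b)
  refine LinearMap.congr_fun (Compl.linearMap_ext_stmul (f := LinearMap.mulLeft Ch (leg1 A a) ∘ₗ
    (leg23Alg A).toLinearMap) (g := cmap (appendLeft a)) fun y z => ?_) (Δ b)
  rw [cmap_toCompl]
  refine (congrArg (leg1 A a * ·) (slift_stmul _ _ (superCommute_leg23 A) y z)).trans ?_
  simp only [leg1, leg2, leg3, AlgHom.comp_apply, toComplAlg_apply, ← toCompl_mul]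
  rw [← mul_assoc, ← map_mul, sinl_mul_sinr, sinl_mul_sinr]
  rfl

theorem coprodLeft_tens {Δ : A →ₐ[Ch] T2 A}
    (hΔ : ∀ x, Δ (parity A x) = parity (T2 A) (Δ x)) (a b : A) :
    coprodLeft Δ (tens a b) = leg12 (Δ a) * leg3 A b := by
  rw [← coprodLeftAlg_apply Δ hΔ]; exact slift_stmul _ _ _ a b

theorem coprodRight_tens {Δ : A →ₐ[Ch] T2 A}
    (hΔ : ∀ x, Δ (parity A x) = parity (T2 A) (Δ x)) (a b : A) :
    coprodRight Δ (tens a b) = leg1 A a * leg23 (Δ b) := by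
  rw [← coprodRightAlg_apply Δ hΔ, ← leg23Alg_apply]; exact slift_stmul _ _ _ a b

theorem convolve_tens (f g : A →ₗ[Ch] A) (a b : A) :
    convolve f g (tens a b) = toCompl (f a * g b) :=
  cmap_toCompl _ _

theorem flip_in1 (a : A) : flip (in1 A a) = in2 A a := by
  refine (cmap_toCompl _ _).trans ?_
  obtain ⟨y, z, hy, hz, rfl⟩ := exists_even_odd a
  have h1 := GradedTensorProduct.comm_coe_tmul_coe (R := Ch) (deg A) (deg A)
    ⟨y, mem_deg_zero.2 hy⟩ (⟨1, mem_deg_zero.2 (map_one _)⟩ : deg A 0)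
  have h2 := GradedTensorProduct.comm_coe_tmul_coe (R := Ch) (deg A) (deg A)
    ⟨z, mem_deg_one.2 hz⟩ (⟨1, mem_deg_zero.2 (map_one _)⟩ : deg A 0)
  simp only [zero_mul, uzpow_zero, one_smul] at h1 h2
  rw [map_add, map_add, map_add, map_add]
  exact congrArg₂ (fun u v => toCompl u + toCompl v) h1 h2

theorem flip_in2 (a : A) : flip (in2 A a) = in1 A a := by
  refine (cmap_toCompl _ _).trans ?_
  obtain ⟨y, z, hy, hz, rfl⟩ := exists_even_odd a
  have h1 := GradedTensorProduct.comm_coe_tmul_coe (R := Ch) (deg A) (deg A)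
    (⟨1, mem_deg_zero.2 (map_one _)⟩ : deg A 0) ⟨y, mem_deg_zero.2 hy⟩
  have h2 := GradedTensorProduct.comm_coe_tmul_coe (R := Ch) (deg A) (deg A)
    (⟨1, mem_deg_zero.2 (map_one _)⟩ : deg A 0) ⟨z, mem_deg_one.2 hz⟩
  simp only [mul_zero, uzpow_zero, one_smul] at h1 h2
  rw [map_add, map_add, map_add, map_add]
  exact congrArg₂ (fun u v => toCompl u + toCompl v) h1 h2

variable (A) in
/-- The homomorphism `flip`. -/
def flipAlg : T2 A →ₐ[Ch] T2 A :=
  cmapAlg (GradedTensorProduct.comm (deg A) (deg A)).toAlgHom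

theorem flipAlg_apply (x : T2 A) : flipAlg A x = flip x := rfl

end Legs

/-! ### The universal property of `U_ħ(gl(1|1))` -/

section Relations

variable {B C : Type} [Ring B] [Algebra Ch B] [Ring C] [Algebra Ch C]

/-- The defining relations of `U_ħ(gl(1|1))` for elements of a completion. -/
structure GLRelations (e f h₁ h₂ : Compl B) : Prop where
  HH : h₁ * h₂ = h₂ * h₁
  H1E : h₁ * e - e * h₁ = e
  H2E : h₂ * e - e * h₂ = -e
  H1F : h₁ * f - f * h₁ = -f
  H2F : h₂ * f - f * h₂ = f
  EF : e * f + f * e = bracket (h₁ + h₂)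
  EE : e * e = 0
  FF : f * f = 0

namespace GLRelations

variable {e f h₁ h₂ : Compl B}

theorem map (r : GLRelations e f h₁ h₂) (φ : Compl B →ₐ[Ch] Compl C) :
    GLRelations (φ e) (φ f) (φ h₁) (φ h₂) where
  HH := by rw [← map_mul, r.HH, map_mul]
  H1E := by rw [← map_mul, ← map_mul, ← map_sub, r.H1E]
  H2E := by rw [← map_mul, ← map_mul, ← map_sub, r.H2E, map_neg]
  H1F := by rw [← map_mul, ← map_mul, ← map_sub, r.H1F, map_neg]
  H2F := by rw [← map_mul, ← map_mul, ← map_sub, r.H2F]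
  EF := by rw [← map_mul, ← map_mul, ← map_add, r.EF, map_bracket, map_add]
  EE := by rw [← map_mul, r.EE, map_zero]
  FF := by rw [← map_mul, r.FF, map_zero]

theorem h₁_mul_e (r : GLRelations e f h₁ h₂) : h₁ * e = e * h₁ + e := by
  rw [← sub_eq_iff_eq_add', r.H1E]

theorem h₂_mul_e (r : GLRelations e f h₁ h₂) : h₂ * e = e * h₂ - e := by
  rw [sub_eq_add_neg, ← sub_eq_iff_eq_add', r.H2E]

theorem h₁_mul_f (r : GLRelations e f h₁ h₂) : h₁ * f = f * h₁ - f := by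
  rw [sub_eq_add_neg, ← sub_eq_iff_eq_add', r.H1F]

theorem h₂_mul_f (r : GLRelations e f h₁ h₂) : h₂ * f = f * h₂ + f := by
  rw [← sub_eq_iff_eq_add', r.H2F]

theorem commute_e (r : GLRelations e f h₁ h₂) : Commute (h₁ + h₂) e := by
  rw [Commute, SemiconjBy, add_mul, mul_add, r.h₁_mul_e, r.h₂_mul_e]; abel

theorem commute_f (r : GLRelations e f h₁ h₂) : Commute (h₁ + h₂) f := by
  rw [Commute, SemiconjBy, add_mul, mul_add, r.h₁_mul_f, r.h₂_mul_f]; abel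

theorem commute_h₁ (r : GLRelations e f h₁ h₂) : Commute (h₁ + h₂) h₁ :=
  (Commute.refl _).add_left r.HH.symm

theorem commute_h₂ (r : GLRelations e f h₁ h₂) : Commute (h₁ + h₂) h₂ :=
  Commute.add_left r.HH (Commute.refl _)

end GLRelations

end Relations

namespace U

variable {B : Type} [Ring B] [Algebra Ch B]

/-- The homomorphism from the completed free algebra. -/
def ofComplFree : Compl FreeAlg →ₐ[Ch] U := (toComplAlg PreU).comp (RingQuot.mkAlgHom Ch Rel)

/-- The homomorphism from the free algebra. -/
def ofFree : FreeAlg →ₐ[Ch] U := ofComplFree.comp (toComplAlg FreeAlg)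

theorem ofFree_ι (g : Gen) : ofFree (FreeAlgebra.ι Ch g) = ofGen g := rfl

/-- The image of the free algebra is dense. -/
theorem linearMap_ext {f g : U →ₗ[Ch] Compl B} (h : ∀ a, f (ofFree a) = g (ofFree a)) : f = g := by
  refine Compl.linearMap_ext fun x => ?_
  obtain ⟨y, rfl⟩ := RingQuot.mkAlgHom_surjective Ch Rel x
  exact LinearMap.congr_fun (Compl.linearMap_ext (f := f ∘ₗ ofComplFree.toLinearMap)
    (g := g ∘ₗ ofComplFree.toLinearMap) h) y

/-- The free algebra has dense image in `U`, and homomorphisms to a completion are continuous. -/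
theorem algHom_ext {f g : U →ₐ[Ch] Compl B} (hE : f E = g E) (hF : f F = g F) (h1 : f H1 = g H1)
    (h2 : f H2 = g H2) : f = g := by
  have h : f.comp ofFree = g.comp ofFree := by
    ext x
    cases x
    exacts [hE, hF, h1, h2]
  exact AlgHom.toLinearMap_injective (linearMap_ext fun a => AlgHom.congr_fun h a)

theorem relations : GLRelations E F H1 H2 := by
  have h : ∀ {x y : Compl FreeAlg}, Rel x y → ofComplFree x = ofComplFree y := fun r =>
    congrArg toCompl (RingQuot.mkAlgHom_rel Ch r)
  refine ⟨?_, ?_, ?_, ?_, ?_, ?_, ?_, ?_⟩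
  · simpa only [map_mul] using! h Rel.HH
  · simpa only [map_mul, map_sub] using! h Rel.H1E
  · simpa only [map_mul, map_sub, map_neg] using! h Rel.H2E
  · simpa only [map_mul, map_sub, map_neg] using! h Rel.H1F
  · simpa only [map_mul, map_sub] using! h Rel.H2F
  · simpa only [map_mul, map_add, map_bracket] using! h Rel.EF
  · simpa only [map_mul, map_zero] using! h Rel.EE
  · simpa only [map_mul, map_zero] using! h Rel.FF

section Lift

variable {e f h₁ h₂ : Compl B}

/-- The images of the generators. -/
def genImage (e f h₁ h₂ : Compl B) : Gen → Compl B
  | .E => e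
  | .F => f
  | .H1 => h₁
  | .H2 => h₂

/-- The homomorphism from the completed free algebra with given values on the generators. -/
def liftFree (e f h₁ h₂ : Compl B) : Compl FreeAlg →ₐ[Ch] Compl B :=
  extendAlg (FreeAlgebra.lift Ch (genImage e f h₁ h₂))

theorem liftFree_gen (g : Gen) : liftFree e f h₁ h₂ (gen g) = genImage e f h₁ h₂ g := by
  rw [liftFree, gen, extendAlg_toCompl, FreeAlgebra.lift_ι_apply]

/-- The homomorphism with given values on the generators. -/
def lift (r : GLRelations e f h₁ h₂) : U →ₐ[Ch] Compl B :=
  extendAlg (RingQuot.liftAlgHom Ch ⟨liftFree e f h₁ h₂, by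
    intro x y h
    cases h <;> simp only [map_mul, map_sub, map_add, map_neg, map_zero, map_bracket, liftFree_gen,
      genImage]
    exacts [r.HH, r.H1E, r.H2E, r.H1F, r.H2F, r.EF, r.EE, r.FF]⟩)

theorem lift_ofGen (r : GLRelations e f h₁ h₂) (g : Gen) :
    lift r (ofGen g) = genImage e f h₁ h₂ g := by
  rw [lift, ofGen, extendAlg_toCompl, RingQuot.liftAlgHom_mkAlgHom_apply]
  exact liftFree_gen g

@[simp] theorem lift_E (r : GLRelations e f h₁ h₂) : lift r E = e := lift_ofGen r .E

@[simp] theorem lift_F (r : GLRelations e f h₁ h₂) : lift r F = f := lift_ofGen r .F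

@[simp] theorem lift_H1 (r : GLRelations e f h₁ h₂) : lift r H1 = h₁ := lift_ofGen r .H1

@[simp] theorem lift_H2 (r : GLRelations e f h₁ h₂) : lift r H2 = h₂ := lift_ofGen r .H2

end Lift

/-! ### Parity -/

theorem parity_ofGen (g : Gen) : parity U (ofGen g) = g.sign • ofGen g := by
  rw [ofGen, parity_toCompl, ← map_smul]
  congr 1
  refine (RingQuot.liftAlgHom_mkAlgHom_apply Ch _ _ _).trans ?_
  rw [AlgHom.comp_apply, parity_gen, map_smul]

theorem parity_E : parity U E = -E :=
  (parity_ofGen .E).trans (by rw [Gen.sign, neg_smul, one_smul]; rfl)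

theorem parity_F : parity U F = -F :=
  (parity_ofGen .F).trans (by rw [Gen.sign, neg_smul, one_smul]; rfl)

theorem parity_H1 : parity U H1 = H1 := (parity_ofGen .H1).trans (by rw [Gen.sign, one_smul]; rfl)

theorem parity_H2 : parity U H2 = H2 := (parity_ofGen .H2).trans (by rw [Gen.sign, one_smul]; rfl)

theorem parity_K : parity U K = K := by
  rw [K, map_hExp, map_add, parity_H1, parity_H2]

theorem parity_Kinv : parity U Kinv = Kinv := by
  rw [Kinv, map_hExp, map_neg, map_add, parity_H1, parity_H2]

theorem K_mul_Kinv : K * Kinv = 1 := hExp_mul_hExp_neg _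

theorem Kinv_mul_K : Kinv * K = 1 := hExp_neg_mul_hExp _

theorem commute_K_E : Commute K E := relations.commute_e.hExp_left

theorem commute_K_F : Commute K F := relations.commute_f.hExp_left

theorem commute_K_H1 : Commute K H1 := relations.commute_h₁.hExp_left

theorem commute_K_H2 : Commute K H2 := relations.commute_h₂.hExp_left

theorem commute_Kinv_E : Commute Kinv E := relations.commute_e.neg_left.hExp_left

theorem commute_Kinv_F : Commute Kinv F := relations.commute_f.neg_left.hExp_left

theorem commute_Kinv_H1 : Commute Kinv H1 := relations.commute_h₁.neg_left.hExp_left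

theorem commute_Kinv_H2 : Commute Kinv H2 := relations.commute_h₂.neg_left.hExp_left

end U

/-! ### Identities in a ring -/

section RingIdentities

variable {R : Type} [Ring R]

theorem mul_mul_of_mul_eq {a b c : R} (h : a * b = c) (z : R) : a * (b * z) = c * z := by
  rw [← mul_assoc, h]

/-- Subscripts name tensor factors, `k` stands for `K` and `l` for `K⁻¹`. The mixed terms cancel in
pairs because odd elements of different factors anticommute. -/
theorem comul_EF_identity {e₁ f₁ k₁ e₂ f₂ l₂ : R} (hk : k₁ * e₁ = e₁ * k₁)
    (hl : l₂ * f₂ = f₂ * l₂) (h₁ : l₂ * f₁ = f₁ * l₂) (h₃ : e₂ * k₁ = k₁ * e₂)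
    (h₂ : l₂ * k₁ = k₁ * l₂) (h₅ : e₂ * f₁ = -(f₁ * e₂)) (h₆ : f₂ * e₁ = -(e₁ * f₂)) :
    (e₁ * l₂ + e₂) * (f₁ + k₁ * f₂) + (f₁ + k₁ * f₂) * (e₁ * l₂ + e₂)
      = (e₁ * f₁ + f₁ * e₁) * l₂ + k₁ * (e₂ * f₂ + f₂ * e₂) := by
  simp only [mul_add, add_mul, mul_assoc, hl, h₁, h₅, mul_mul_of_mul_eq hk,
    mul_mul_of_mul_eq h₃, mul_mul_of_mul_eq h₂, mul_mul_of_mul_eq h₆, neg_mul, mul_neg]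
  abel

theorem comul_EE_identity {e₁ e₂ l₂ : R} (h₁ : e₁ * e₁ = 0) (h₂ : e₂ * e₂ = 0)
    (h₃ : l₂ * e₁ = e₁ * l₂) (h₄ : l₂ * e₂ = e₂ * l₂) (h₅ : e₂ * e₁ = -(e₁ * e₂)) :
    (e₁ * l₂ + e₂) * (e₁ * l₂ + e₂) = 0 := by
  simp only [mul_add, add_mul, mul_assoc, h₂, h₄, mul_mul_of_mul_eq h₁, mul_mul_of_mul_eq h₃,
    mul_mul_of_mul_eq h₅, neg_mul, zero_mul]
  abel

theorem comul_FF_identity {f₁ k₁ f₂ : R} (h₁ : f₁ * f₁ = 0) (h₂ : f₂ * f₂ = 0)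
    (h₃ : k₁ * f₁ = f₁ * k₁) (h₄ : f₂ * k₁ = k₁ * f₂) (h₅ : f₂ * f₁ = -(f₁ * f₂)) :
    (f₁ + k₁ * f₂) * (f₁ + k₁ * f₂) = 0 := by
  simp only [mul_add, add_mul, mul_assoc, h₁, h₂, h₅, mul_mul_of_mul_eq h₃, mul_mul_of_mul_eq h₄,
    mul_neg, mul_zero]
  abel

theorem comul_weight_identity {x y z h h' : R} (hx : h * x - x * h = z) (hx' : h' * x = x * h')
    (hy : h' * y = y * h') (hy' : h * y = y * h) :
    (h + h') * (x * y) - (x * y) * (h + h') = z * y := by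
  simp only [← hx, mul_add, add_mul, sub_mul, mul_assoc, hy, hy', mul_mul_of_mul_eq hx']
  abel

theorem comul_weight_identity' {x y z h h' : R} (hx : h' * y - y * h' = z) (hx' : h * x = x * h)
    (hy : h' * x = x * h') (hy' : h * y = y * h) :
    (h + h') * (x * y) - (x * y) * (h + h') = x * z := by
  simp only [← hx, mul_add, add_mul, mul_sub, mul_assoc, hy', mul_mul_of_mul_eq hx',
    mul_mul_of_mul_eq hy]
  abel

end RingIdentities

/-! ### Existence of the comultiplication -/

namespace U

/-- The generators of one tensor factor. -/
theorem relations_in1 : GLRelations (in1 U E) (in1 U F) (in1 U H1) (in1 U H2) :=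
  relations.map (in1 U)

theorem relations_in2 : GLRelations (in2 U E) (in2 U F) (in2 U H1) (in2 U H2) :=
  relations.map (in2 U)

theorem in2_mul_in1_of_even (x : U) {y : U} (hy : parity U y = y) :
    in2 U y * in1 U x = in1 U x * in2 U y := ((superCommute_in U).even x y hy).symm

theorem in2_mul_in1_of_even' {x : U} (y : U) (hx : parity U x = x) :
    in2 U y * in1 U x = in1 U x * in2 U y := (superCommute_in U).symm.even y x hx

theorem in2_mul_in1_of_odd {x y : U} (hx : parity U x = -x) (hy : parity U y = -y) :
    in2 U y * in1 U x = -(in1 U x * in2 U y) := by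
  rw [(superCommute_in U).symm.odd y x hx, hy, map_neg, mul_neg]

theorem comm_in1_in2 {x y h : U} {c : U} (hh : parity U h = h) (hy : parity U y = y)
    (hc : h * x - x * h = c) (hyh : h * y = y * h) :
    (in1 U h + in2 U h) * (in1 U x * in2 U y) - (in1 U x * in2 U y) * (in1 U h + in2 U h)
      = in1 U c * in2 U y := by
  refine comul_weight_identity ?_ (in2_mul_in1_of_even x hh) ?_ ?_
  · rw [← map_mul, ← map_mul, ← map_sub, hc]
  · rw [← map_mul, hyh, map_mul]
  · exact (in2_mul_in1_of_even h hy).symm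

theorem comm_in1_in2' {x y h : U} {c : U} (hh : parity U h = h)
    (hc : h * y - y * h = c) (hxh : h * x = x * h) :
    (in1 U h + in2 U h) * (in1 U x * in2 U y) - (in1 U x * in2 U y) * (in1 U h + in2 U h)
      = in1 U x * in2 U c := by
  refine comul_weight_identity' ?_ ?_ (in2_mul_in1_of_even x hh) ?_
  · rw [← map_mul, ← map_mul, ← map_sub, hc]
  · rw [← map_mul, hxh, map_mul]
  · exact (in2_mul_in1_of_even' y hh).symm

theorem comul_comm_E {h c : U} (hh : parity U h = h) (hc : h * E - E * h = c)
    (hk : Commute Kinv h) :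
    (in1 U h + in2 U h) * (in1 U E * in2 U Kinv + in2 U E)
      - (in1 U E * in2 U Kinv + in2 U E) * (in1 U h + in2 U h)
      = in1 U c * in2 U Kinv + in2 U c := by
  have h1 := comm_in1_in2 hh parity_Kinv hc hk.symm.eq
  -- The summand `1 ⊗ E` is treated as a product whose first factor has weight zero.
  have h2 := comm_in1_in2' (x := 1) hh hc (by rw [mul_one, one_mul])
  rw [map_one, one_mul, one_mul] at h2
  rw [mul_add, add_mul _ _ (_ + _), ← h1, ← h2]
  abel

theorem comul_comm_F {h c : U} (hh : parity U h = h) (hc : h * F - F * h = c)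
    (hk : Commute K h) :
    (in1 U h + in2 U h) * (in1 U F + in1 U K * in2 U F)
      - (in1 U F + in1 U K * in2 U F) * (in1 U h + in2 U h)
      = in1 U c + in1 U K * in2 U c := by
  have h1 := comm_in1_in2 (y := 1) hh (map_one _) hc (by rw [mul_one, one_mul])
  have h2 := comm_in1_in2' hh hc hk.symm.eq
  rw [map_one, mul_one, mul_one] at h1
  rw [mul_add, add_mul _ _ (_ + _), ← h1, ← h2]
  abel

theorem in1_K : in1 U K = hExp (in1 U H1 + in1 U H2) := by rw [K, map_hExp, map_add]

theorem in2_Kinv : in2 U Kinv = hExp (-(in2 U H1 + in2 U H2)) := by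
  rw [Kinv, map_hExp, map_neg, map_add]

theorem comul_relations : GLRelations (in1 U E * in2 U Kinv + in2 U E)
    (in1 U F + in1 U K * in2 U F) (in1 U H1 + in2 U H1) (in1 U H2 + in2 U H2) where
  HH := by
    have h1 := relations_in1.HH
    have h2 := relations_in2.HH
    have h3 := in2_mul_in1_of_even H1 parity_H2
    have h4 := in2_mul_in1_of_even H2 parity_H1
    simp only [mul_add, add_mul, h1, h2, h3, h4]
    abel
  H1E := comul_comm_E parity_H1 relations.H1E commute_Kinv_H1
  H2E := by
    rw [comul_comm_E parity_H2 relations.H2E commute_Kinv_H2, map_neg, map_neg, neg_mul]; abel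
  H1F := by
    rw [comul_comm_F parity_H1 relations.H1F commute_K_H1, map_neg, map_neg, mul_neg]; abel
  H2F := comul_comm_F parity_H2 relations.H2F commute_K_H2
  EF := by
    -- What remains is `[a] e^(-ħb) + e^(ħa) [b]`, with `a`, `b` the copies of `H_1 + H_2` in the
    -- two factors, and `bracket_add` sums it up.
    rw [comul_EF_identity (commute_K_E.map (in1 U)).eq (commute_Kinv_F.map (in2 U)).eq
      (in2_mul_in1_of_even F parity_Kinv) (in2_mul_in1_of_even' E parity_K)
      (in2_mul_in1_of_even K parity_Kinv) (in2_mul_in1_of_odd parity_F parity_E)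
      (in2_mul_in1_of_odd parity_E parity_F), relations_in1.EF, relations_in2.EF, in1_K, in2_Kinv,
      ← bracket_add, add_add_add_comm]
    rw [← map_add, ← map_add]
    exact (in2_mul_in1_of_even _ (by rw [map_add, parity_H1, parity_H2])).symm
  EE := comul_EE_identity relations_in1.EE relations_in2.EE (in2_mul_in1_of_even E parity_Kinv)
    (commute_Kinv_E.map (in2 U)).eq (in2_mul_in1_of_odd parity_E parity_E)
  FF := comul_FF_identity relations_in1.FF relations_in2.FF (commute_K_F.map (in1 U)).eq
    (in2_mul_in1_of_even' F parity_K) (in2_mul_in1_of_odd parity_F parity_F)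

/-- The comultiplication. -/
def comul : U →ₐ[Ch] T2 U := lift comul_relations

theorem comul_E : comul E = in1 U E * in2 U Kinv + in2 U E := lift_E _

theorem comul_F : comul F = in1 U F + in1 U K * in2 U F := lift_F _

theorem comul_H1 : comul H1 = in1 U H1 + in2 U H1 := lift_H1 _

theorem comul_H2 : comul H2 = in1 U H2 + in2 U H2 := lift_H2 _

theorem parity_in1 (x : U) : parity (T2 U) (in1 U x) = in1 U (parity U x) := by
  rw [in1, AlgHom.comp_apply, toComplAlg_apply, parity_toCompl, ← sinl_parity]; rfl

theorem parity_in2 (x : U) : parity (T2 U) (in2 U x) = in2 U (parity U x) := by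
  rw [in2, AlgHom.comp_apply, toComplAlg_apply, parity_toCompl, ← sinr_parity]; rfl

theorem comul_parity (x : U) : comul (parity U x) = parity (T2 U) (comul x) := by
  have h : comul.comp (parity U) = (parity (T2 U)).comp comul := by
    apply algHom_ext <;>
    simp only [AlgHom.comp_apply, parity_E, parity_F, parity_H1, parity_H2, map_neg, comul_E,
      comul_F, comul_H1, comul_H2, map_add, map_mul, parity_in1, parity_in2, parity_K,
      parity_Kinv, neg_mul, mul_neg, neg_add]
  exact AlgHom.congr_fun h x

/-! ### The counit -/

/-- The counit, with values in the completion of the ground ring. -/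
def counitCompl : U →ₐ[Ch] Compl Ch :=
  lift (e := 0) (f := 0) (h₁ := 0) (h₂ := 0) (by constructor <;> simp [bracket_zero])

/-- The counit. -/
def counit : U →ₐ[Ch] Ch := (complEquiv Ch).symm.toAlgHom.comp counitCompl

theorem counit_apply (x : U) : counit x = (complEquiv Ch).symm (counitCompl x) := rfl

theorem counit_E : counit E = 0 := by rw [counit_apply, counitCompl, lift_E, map_zero]

theorem counit_F : counit F = 0 := by rw [counit_apply, counitCompl, lift_F, map_zero]

theorem counit_H1 : counit H1 = 0 := by rw [counit_apply, counitCompl, lift_H1, map_zero]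

theorem counit_H2 : counit H2 = 0 := by rw [counit_apply, counitCompl, lift_H2, map_zero]

/-- Algebra homomorphisms to a complete algebra are determined on the generators. -/
theorem algHom_ext_of_complete {B : Type} [Ring B] [Algebra Ch B] [IsAdicComplete hIdeal B]
    {f g : U →ₐ[Ch] B} (hE : f E = g E) (hF : f F = g F) (h1 : f H1 = g H1)
    (h2 : f H2 = g H2) : f = g := by
  have h : (toComplAlg B).comp f = (toComplAlg B).comp g := by
    apply algHom_ext <;> simp only [AlgHom.comp_apply, hE, hF, h1, h2]
  exact AlgHom.ext fun x => toCompl_injective (AlgHom.congr_fun h x)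

theorem counit_parity (x : U) : counit (parity U x) = counit x := by
  have h : counit.comp (parity U) = counit := by
    apply algHom_ext_of_complete <;>
    simp [parity_E, parity_F, parity_H1, parity_H2, counit_E, counit_F]
  exact AlgHom.congr_fun h x

/-- `hExp` makes sense only in a completion, so the value is computed in `Compl B`, into which the
complete algebra `B` embeds. -/
theorem map_hExp_of_complete {B : Type} [Ring B] [Algebra Ch B] [IsAdicComplete hIdeal B]
    (f : U →ₐ[Ch] B) {x : U} (hx : f x = 0) : f (hExp x) = 1 := by
  apply toCompl_injective
  have := map_hExp ((toComplAlg B).comp f) x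
  simp only [AlgHom.comp_apply, hx, map_zero, hExp_zero] at this
  exact this

theorem counit_K : counit K = 1 :=
  map_hExp_of_complete counit (by rw [map_add, counit_H1, counit_H2, add_zero])

theorem counit_Kinv : counit Kinv = 1 :=
  map_hExp_of_complete counit (by rw [map_neg, map_add, counit_H1, counit_H2, add_zero, neg_zero])

end U

/-! ### Super anti-homomorphisms

A super anti-homomorphism becomes an anti-homomorphism when its values on odd elements are
multiplied by `√-1`. -/

section Twist

variable (A : Type) [Ring A] [Algebra Ch A] [Superalgebra A]

/-- The multiplication of odd elements by `c`. -/
def twist (c : ℂ) : A →ₗ[Ch] A :=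
  (PowerSeries.C ((1 + c) / 2) : Ch) • LinearMap.id +
    (PowerSeries.C ((1 - c) / 2) : Ch) • (parity A).toLinearMap

variable {A}

theorem twist_even (c : ℂ) {x : A} (hx : parity A x = x) : twist A c x = x := by
  simp only [twist, LinearMap.add_apply, LinearMap.smul_apply, LinearMap.id_apply,
    AlgHom.toLinearMap_apply, hx]
  rw [← add_smul, ← map_add]
  have : (1 + c) / 2 + (1 - c) / 2 = 1 := by ring
  rw [this, map_one, one_smul]

theorem twist_odd (c : ℂ) {x : A} (hx : parity A x = -x) :
    twist A c x = (PowerSeries.C c : Ch) • x := by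
  simp only [twist, LinearMap.add_apply, LinearMap.smul_apply, LinearMap.id_apply,
    AlgHom.toLinearMap_apply, hx]
  rw [smul_neg, ← sub_eq_add_neg, ← sub_smul, ← map_sub]
  congr 2
  ring

theorem twist_twist {c d : ℂ} (h : c * d = 1) (x : A) : twist A c (twist A d x) = x := by
  obtain ⟨y, z, hy, hz, rfl⟩ := exists_even_odd x
  rw [map_add, map_add, twist_even d hy, twist_odd d hz, twist_even c hy, map_smul, twist_odd c hz,
    smul_smul, ← map_mul, mul_comm, h, map_one, one_smul]

end Twist

section Opposite

variable (A : Type) [Ring A] [Algebra Ch A] [IsAdicComplete hIdeal A]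

open MulOpposite in
/-- A complete algebra as the completion of its opposite. -/
def opCompl : A ≃ₗ[Ch] Compl Aᵐᵒᵖ :=
  LinearEquiv.ofLinearMap (toCompl ∘ₗ (opLinearEquiv Ch).toLinearMap)
    ((complEquiv A).symm.toLinearMap ∘ₗ cmap (opLinearEquiv Ch).symm.toLinearMap)
    (by
      refine Compl.linearMap_ext fun a => ?_
      simp only [LinearMap.comp_apply, cmap_toCompl]
      exact congrArg (fun z => toCompl (op z)) (complEquiv_symm_toCompl (unop a)))
    (by
      refine LinearMap.ext fun a => ?_
      simp only [LinearMap.comp_apply, cmap_toCompl]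
      exact complEquiv_symm_toCompl a)

variable {A}

theorem opCompl_mul (a b : A) : opCompl A (a * b) = opCompl A b * opCompl A a :=
  toCompl_mul (MulOpposite.op b) (MulOpposite.op a)

theorem opCompl_one : opCompl A 1 = 1 := rfl

theorem opCompl_pow (a : A) (m : ℕ) : opCompl A (a ^ m) = opCompl A a ^ m := by
  induction m with
  | zero => rw [pow_zero, pow_zero, opCompl_one]
  | succ m ih => rw [pow_succ, opCompl_mul, ih, pow_succ']

theorem opCompl_symm_mul (a b : Compl Aᵐᵒᵖ) :
    (opCompl A).symm (a * b) = (opCompl A).symm b * (opCompl A).symm a := by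
  apply (opCompl A).injective
  rw [opCompl_mul, LinearEquiv.apply_symm_apply, LinearEquiv.apply_symm_apply,
    LinearEquiv.apply_symm_apply]

theorem opCompl_hExp {B : Type} [Ring B] [Algebra Ch B] (a : Compl B) :
    opCompl (Compl B) (hExp a) = hExp (opCompl (Compl B) a) := by
  refine (map_hSum (opCompl (Compl B)).toLinearMap _).trans ?_
  simp [hExp, opCompl_pow]

theorem opCompl_bracket {B : Type} [Ring B] [Algebra Ch B] (a : Compl B) :
    opCompl (Compl B) (bracket a) = bracket (opCompl (Compl B) a) := by
  rw [bracket, map_smul]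
  refine congrArg _ ((map_hSum (opCompl (Compl B)).toLinearMap _).trans ?_)
  simp [opCompl_pow]

end Opposite

/-- The scalar `√-1`. -/
abbrev imag : Ch := PowerSeries.C Complex.I

theorem imag_mul_imag : imag * imag = -1 := by
  rw [← map_mul, Complex.I_mul_I, map_neg, map_one]

/-! ### Existence and uniqueness of the antipode -/

namespace U

theorem antipode_EF_identity : Kinv * F * (E * K) + E * K * (Kinv * F) = bracket (H1 + H2) := by
  rw [mul_assoc E K, ← mul_assoc K, K_mul_Kinv, one_mul, commute_Kinv_F.eq, mul_assoc F,
    ← mul_assoc Kinv, commute_Kinv_E.eq, mul_assoc E, Kinv_mul_K, mul_one, add_comm, relations.EF]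

/-- The images are `S(H_i)`, `√-1 S(E)` and `√-1 S(F)`, read in the opposite algebra. In the
relation for `EF + FE` the factor `(√-1)² = -1` matches the sign of the bracket of `-(H_1 + H_2)`.
-/
theorem antipode_relations : GLRelations (opCompl U (-(imag • (E * K))))
    (opCompl U (-(imag • (Kinv * F)))) (opCompl U (-H1)) (opCompl U (-H2)) where
  HH := by
    rw [← opCompl_mul, ← opCompl_mul, neg_mul_neg, neg_mul_neg, relations.HH]
  H1E := by
    rw [← opCompl_mul, ← opCompl_mul, ← map_sub, neg_mul_neg, neg_mul_neg, smul_mul_assoc,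
      mul_smul_comm, ← smul_sub, mul_assoc, commute_K_H1.eq, ← mul_assoc, ← mul_assoc, ← sub_mul,
      ← neg_sub (H1 * E), relations.H1E, neg_mul, smul_neg]
  H2E := by
    rw [← opCompl_mul, ← opCompl_mul, ← map_sub, neg_mul_neg, neg_mul_neg, smul_mul_assoc,
      mul_smul_comm, ← smul_sub, mul_assoc, commute_K_H2.eq, ← mul_assoc, ← mul_assoc, ← sub_mul,
      ← neg_sub (H2 * E), relations.H2E, neg_neg, ← map_neg, neg_neg]
  H1F := by
    rw [← opCompl_mul, ← opCompl_mul, ← map_sub, neg_mul_neg, neg_mul_neg, smul_mul_assoc,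
      mul_smul_comm, ← smul_sub, ← mul_assoc, ← commute_Kinv_H1.eq, mul_assoc, mul_assoc, ← mul_sub,
      ← neg_sub (H1 * F), relations.H1F, neg_neg, ← map_neg, neg_neg]
  H2F := by
    rw [← opCompl_mul, ← opCompl_mul, ← map_sub, neg_mul_neg, neg_mul_neg, smul_mul_assoc,
      mul_smul_comm, ← smul_sub, ← mul_assoc, ← commute_Kinv_H2.eq, mul_assoc, mul_assoc, ← mul_sub,
      ← neg_sub (H2 * F), relations.H2F, mul_neg, smul_neg]
  EF := by
    rw [← opCompl_mul, ← opCompl_mul, ← map_add, ← map_add, ← neg_add, neg_mul_neg, neg_mul_neg,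
      smul_mul_smul_comm, smul_mul_smul_comm, imag_mul_imag, ← smul_add, antipode_EF_identity,
      ← opCompl_bracket, bracket_neg, neg_smul, one_smul]
  EE := by
    rw [← opCompl_mul, neg_mul_neg, smul_mul_smul_comm, mul_assoc, ← mul_assoc K, commute_K_E.eq,
      mul_assoc E K, ← mul_assoc E E, relations.EE, zero_mul, smul_zero, map_zero]
  FF := by
    rw [← opCompl_mul, neg_mul_neg, smul_mul_smul_comm, mul_assoc, ← mul_assoc F,
      ← commute_Kinv_F.eq, mul_assoc Kinv F, relations.FF, mul_zero, mul_zero, smul_zero, map_zero]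

/-- The anti-homomorphism which is the antipode on even and `√-1` times the antipode on odd
elements. -/
def antipodeOp : U →ₐ[Ch] Compl Uᵐᵒᵖ := lift antipode_relations

/-- The antipode. -/
def antipode : U →ₗ[Ch] U :=
  -- The twist by `-√-1` removes the factor `√-1` which `antipodeOp` carries on odd elements.
  (opCompl U).symm.toLinearMap ∘ₗ antipodeOp.toLinearMap ∘ₗ twist U (-Complex.I)

theorem antipode_of_even {x : U} (hx : parity U x = x) :
    antipode x = (opCompl U).symm (antipodeOp x) := by
  simp only [antipode, LinearMap.comp_apply, twist_even _ hx]; rfl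

theorem antipode_of_odd {x : U} (hx : parity U x = -x) :
    antipode x = -(imag • (opCompl U).symm (antipodeOp x)) := by
  simp only [antipode, LinearMap.comp_apply, twist_odd _ hx, map_smul, map_neg, neg_smul]; rfl

theorem antipode_E : antipode E = -(E * K) := by
  rw [antipode_of_odd parity_E, antipodeOp, lift_E, LinearEquiv.symm_apply_apply, smul_neg,
    smul_smul, imag_mul_imag, neg_smul, one_smul, neg_neg]

theorem antipode_F : antipode F = -(Kinv * F) := by
  rw [antipode_of_odd parity_F, antipodeOp, lift_F, LinearEquiv.symm_apply_apply, smul_neg,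
    smul_smul, imag_mul_imag, neg_smul, one_smul, neg_neg]

theorem antipode_H1 : antipode H1 = -H1 := by
  rw [antipode_of_even parity_H1, antipodeOp, lift_H1, LinearEquiv.symm_apply_apply]

theorem antipode_H2 : antipode H2 = -H2 := by
  rw [antipode_of_even parity_H2, antipodeOp, lift_H2, LinearEquiv.symm_apply_apply]

theorem antipode_one : antipode 1 = 1 := by
  rw [antipode_of_even (map_one _), map_one, ← opCompl_one, LinearEquiv.symm_apply_apply]

theorem antipode_mul_of_even {x : U} (y : U) (hx : parity U x = x) :
    antipode (x * y) = antipode y * antipode x := by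
  obtain ⟨u, v, hu, hv, rfl⟩ := exists_even_odd y
  rw [mul_add, map_add, map_add, add_mul, antipode_of_even hx, antipode_of_even hu,
    antipode_of_odd hv, antipode_of_even (by rw [map_mul, hx, hu]),
    antipode_of_odd (x := x * v) (by rw [map_mul, hx, hv, mul_neg]), map_mul antipodeOp,
    map_mul antipodeOp, opCompl_symm_mul, opCompl_symm_mul, neg_mul, smul_mul_assoc]

/-- On odd `y` the two factors `√-1` multiply to the sign `-1`; applying the parity automorphism to
`y` expresses the sign without assuming `y` homogeneous. -/
theorem antipode_mul_of_odd {x : U} (y : U) (hx : parity U x = -x) :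
    antipode (x * y) = antipode (parity U y) * antipode x := by
  obtain ⟨u, v, hu, hv, rfl⟩ := exists_even_odd y
  rw [map_add (parity U), hu, hv, mul_add, map_add, map_add, map_neg, add_mul, antipode_of_odd hx,
    antipode_of_even hu, antipode_of_odd hv,
    antipode_of_odd (x := x * u) (by rw [map_mul, hx, hu, neg_mul]),
    antipode_of_even (by rw [map_mul, hx, hv, neg_mul_neg]), map_mul antipodeOp,
    map_mul antipodeOp, opCompl_symm_mul, opCompl_symm_mul, neg_neg, mul_neg, mul_neg, mul_smul_comm,
    smul_mul_smul_comm, imag_mul_imag, neg_smul, one_smul, neg_neg]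

theorem antipode_mul (i j : ZMod 2) (x y : U) (hx : x ∈ deg U i) (hy : y ∈ deg U j) :
    antipode (x * y) = (-1 : ℤˣ) ^ (i * j) • (antipode y * antipode x) := by
  have key : ∀ k : ZMod 2, k = 0 ∨ k = 1 := by decide
  rcases key i with rfl | rfl
  · rw [antipode_mul_of_even y (mem_deg_zero.1 hx), zero_mul, uzpow_zero, one_smul]
  · rw [antipode_mul_of_odd y (mem_deg_one.1 hx)]
    rcases key j with rfl | rfl
    · rw [mem_deg_zero.1 hy, mul_zero, uzpow_zero, one_smul]
    · rw [mem_deg_one.1 hy, one_mul, uzpow_one, map_neg, neg_mul, Units.neg_smul, one_smul]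

theorem antipode_hExp {x : U} (hx : parity U x = x) (h : antipode x = -x) :
    antipode (hExp x) = hExp (-x) := by
  rw [antipode_of_even hx] at h
  rw [antipode_of_even (by rw [map_hExp, hx]), map_hExp, ← h]
  apply (opCompl U).injective
  rw [opCompl_hExp, LinearEquiv.apply_symm_apply, LinearEquiv.apply_symm_apply]

theorem antipode_K : antipode K = Kinv :=
  antipode_hExp (by rw [map_add, parity_H1, parity_H2])
    (by rw [map_add, antipode_H1, antipode_H2, neg_add])

theorem antipode_Kinv : antipode Kinv = K := by
  rw [Kinv, antipode_hExp, neg_neg, K]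
  · rw [map_neg, map_add, parity_H1, parity_H2]
  · rw [map_neg, map_add, antipode_H1, antipode_H2, neg_add H1]

/-- A super anti-homomorphism is determined on the generators. -/
theorem antipode_unique (S : U →ₗ[Ch] U) (hE : S E = -(E * K)) (hF : S F = -(Kinv * F))
    (h1 : S H1 = -H1) (h2 : S H2 = -H2) (hone : S 1 = 1)
    (hmul : ∀ (i j : ZMod 2) (x y : U), x ∈ deg U i → y ∈ deg U j →
      S (x * y) = (-1 : ℤˣ) ^ (i * j) • (S y * S x)) : S = antipode := by
  -- Twisting any candidate `S` by `√-1` gives a genuine homomorphism to the opposite algebra, which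
  -- can be compared with `antipodeOp` on generators.
  let φ : U →ₗ[Ch] Compl Uᵐᵒᵖ := (opCompl U).toLinearMap ∘ₗ S ∘ₗ twist U Complex.I
  have φe : ∀ {x : U}, parity U x = x → φ x = opCompl U (S x) := fun hx => by
    simp only [φ, LinearMap.comp_apply, twist_even _ hx]; rfl
  have φo : ∀ {x : U}, parity U x = -x → φ x = imag • opCompl U (S x) := fun hx => by
    simp only [φ, LinearMap.comp_apply, twist_odd _ hx, map_smul]; rfl
  have hφ : ∀ x y, φ (x * y) = φ x * φ y := by
    intro x y
    obtain ⟨a, b, ha, hb, rfl⟩ := exists_even_odd x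
    obtain ⟨c, d, hc, hd, rfl⟩ := exists_even_odd y
    have e1 := hmul 0 0 a c (mem_deg_zero.2 ha) (mem_deg_zero.2 hc)
    have e2 := hmul 0 1 a d (mem_deg_zero.2 ha) (mem_deg_one.2 hd)
    have e3 := hmul 1 0 b c (mem_deg_one.2 hb) (mem_deg_zero.2 hc)
    have e4 := hmul 1 1 b d (mem_deg_one.2 hb) (mem_deg_one.2 hd)
    simp only [zero_mul, mul_zero, one_mul, uzpow_zero, uzpow_one, one_smul, Units.neg_smul]
      at e1 e2 e3 e4
    have m1 : φ (a * c) = φ a * φ c := by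
      rw [φe ha, φe hc, φe (by rw [map_mul, ha, hc]), e1, opCompl_mul]
    have m2 : φ (a * d) = φ a * φ d := by
      rw [φe ha, φo hd, φo (by rw [map_mul, ha, hd, mul_neg]), e2, opCompl_mul, mul_smul_comm]
    have m3 : φ (b * c) = φ b * φ c := by
      rw [φo hb, φe hc, φo (by rw [map_mul, hb, hc, neg_mul]), e3, opCompl_mul, smul_mul_assoc]
    have m4 : φ (b * d) = φ b * φ d := by
      rw [φo hb, φo hd, φe (by rw [map_mul, hb, hd, neg_mul_neg]), e4, map_neg, opCompl_mul,
        smul_mul_smul_comm, imag_mul_imag, neg_smul, one_smul]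
    simp only [mul_add, add_mul, map_add, m1, m2, m3, m4]
  have hφ1 : φ 1 = 1 := by rw [φe (map_one _), hone, opCompl_one]
  have key : AlgHom.ofLinearMap φ hφ1 hφ = antipodeOp := by
    apply algHom_ext
    · rw [AlgHom.ofLinearMap_apply, φo parity_E, hE, antipodeOp, lift_E, ← map_smul, smul_neg]
    · rw [AlgHom.ofLinearMap_apply, φo parity_F, hF, antipodeOp, lift_F, ← map_smul, smul_neg]
    · rw [AlgHom.ofLinearMap_apply, φe parity_H1, h1, antipodeOp, lift_H1]
    · rw [AlgHom.ofLinearMap_apply, φe parity_H2, h2, antipodeOp, lift_H2]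
  refine LinearMap.ext fun x => ?_
  -- Evaluating at the inversely twisted element cancels the twist in `φ`.
  have := AlgHom.congr_fun key (twist U (-Complex.I) x)
  rw [AlgHom.ofLinearMap_apply] at this
  simp only [φ, LinearMap.comp_apply] at this
  rw [twist_twist (by rw [mul_neg, Complex.I_mul_I, neg_neg])] at this
  exact ((opCompl U).symm_apply_apply (S x)).symm.trans (congrArg (opCompl U).symm this)

theorem antipode_parity (x : U) : antipode (parity U x) = parity U (antipode x) := by
  -- The conjugate of the antipode by the parity automorphism is again a super anti-homomorphism
  -- with the same values on generators, so uniqueness applies.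
  suffices h : (parity U).toLinearMap ∘ₗ antipode ∘ₗ (parity U).toLinearMap = antipode by
    have := LinearMap.congr_fun h x
    rw [← this]
    exact (Superalgebra.parity_parity _).symm
  have hE : parity U (-(E * K)) = E * K := by
    rw [map_neg, map_mul, parity_E, parity_K, neg_mul, neg_neg]
  have hF : parity U (-(Kinv * F)) = Kinv * F := by
    rw [map_neg, map_mul, parity_F, parity_Kinv, mul_neg, neg_neg]
  apply antipode_unique <;> simp only [LinearMap.comp_apply, AlgHom.toLinearMap_apply]
  · rw [parity_E, map_neg, map_neg, antipode_E, hE]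
  · rw [parity_F, map_neg, map_neg, antipode_F, hF]
  · rw [parity_H1, antipode_H1, map_neg, parity_H1]
  · rw [parity_H2, antipode_H2, map_neg, parity_H2]
  · rw [map_one, antipode_one, map_one]
  · intro i j x y hx hy
    have h : ∀ {k : ZMod 2} {z : U}, z ∈ deg U k → parity U z ∈ deg U k := fun {k z} hz => by
      rw [mem_deg, mem_deg.1 hz, Units.smul_def, map_zsmul, mem_deg.1 hz]; rfl
    rw [map_mul, antipode_mul i j _ _ (h hx) (h hy), Units.smul_def, map_zsmul, map_mul]
    rfl

end U

/-! ### Leg embeddings and coproducts on the two tensor factors -/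

section LegValues

variable {A : Type} [Ring A] [Algebra Ch A] [Superalgebra A]

theorem in1_eq_tens (a : A) : in1 A a = tens a 1 := rfl

theorem in2_eq_tens (a : A) : in2 A a = tens 1 a := rfl

theorem leg12Alg_in1 (a : A) : leg12Alg A (in1 A a) = leg1 A a := by
  rw [leg12Alg_apply, in1_eq_tens, leg12_tens, map_one, mul_one]

theorem leg12Alg_in2 (a : A) : leg12Alg A (in2 A a) = leg2 A a := by
  rw [leg12Alg_apply, in2_eq_tens, leg12_tens, map_one, one_mul]

theorem leg13Alg_in1 (a : A) : leg13Alg A (in1 A a) = leg1 A a := by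
  rw [leg13Alg_apply, in1_eq_tens, leg13_tens, map_one, mul_one]

theorem leg13Alg_in2 (a : A) : leg13Alg A (in2 A a) = leg3 A a := by
  rw [leg13Alg_apply, in2_eq_tens, leg13_tens, map_one, one_mul]

theorem leg23Alg_in1 (a : A) : leg23Alg A (in1 A a) = leg2 A a := by
  rw [leg23Alg_apply, in1_eq_tens, leg23_tens, map_one, mul_one]

theorem leg23Alg_in2 (a : A) : leg23Alg A (in2 A a) = leg3 A a := by
  rw [leg23Alg_apply, in2_eq_tens, leg23_tens, map_one, one_mul]

variable (Δ : A →ₐ[Ch] T2 A) (hΔ : ∀ x, Δ (parity A x) = parity (T2 A) (Δ x))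

theorem coprodLeftAlg_in1 (a : A) : coprodLeftAlg Δ hΔ (in1 A a) = leg12Alg A (Δ a) := by
  rw [coprodLeftAlg_apply, in1_eq_tens, coprodLeft_tens hΔ, map_one, mul_one, leg12Alg_apply]

theorem coprodLeftAlg_in2 (a : A) : coprodLeftAlg Δ hΔ (in2 A a) = leg3 A a := by
  rw [coprodLeftAlg_apply, in2_eq_tens, coprodLeft_tens hΔ, map_one, ← leg12Alg_apply, map_one,
    one_mul]

theorem coprodRightAlg_in1 (a : A) : coprodRightAlg Δ hΔ (in1 A a) = leg1 A a := by
  rw [coprodRightAlg_apply, in1_eq_tens, coprodRight_tens hΔ, map_one, ← leg23Alg_apply, map_one,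
    mul_one]

theorem coprodRightAlg_in2 (a : A) : coprodRightAlg Δ hΔ (in2 A a) = leg23Alg A (Δ a) := by
  rw [coprodRightAlg_apply, in2_eq_tens, coprodRight_tens hΔ, map_one, one_mul, leg23Alg_apply]

end LegValues

/-! ### Convolution -/

section Convolution

theorem unitCounit_one {A : Type} [Ring A] [Algebra Ch A] (ε : A →ₐ[Ch] Ch) : unitCounit ε 1 = 1 := by
  simp [unitCounit]

theorem toCompl_algebraMap {A : Type} [Ring A] [Algebra Ch A] (c : Ch) :
    toCompl (algebraMap Ch A c) = algebraMap Ch (Compl A) c := (toComplAlg A).commutes c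

variable {A : Type} [Ring A] [Algebra Ch A] [Superalgebra A]

theorem convolve_in1 (f g : A →ₗ[Ch] A) (hg : g 1 = 1) (a : A) :
    convolve f g (in1 A a) = toCompl (f a) := by
  rw [in1_eq_tens, convolve_tens, hg, mul_one]

theorem convolve_in2 (f g : A →ₗ[Ch] A) (hf : f 1 = 1) (a : A) :
    convolve f g (in2 A a) = toCompl (g a) := by
  rw [in2_eq_tens, convolve_tens, hf, one_mul]

/-- The composition of the unit and an even counit supercommutes with every homomorphism. -/
theorem superCommute_counit (ε : A →ₐ[Ch] Ch) (hε : ∀ x, ε (parity A x) = ε x) {C : Type} [Ring C]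
    [Algebra Ch C] (g : A →ₐ[Ch] C) : SuperCommute ((Algebra.ofId Ch C).comp ε) g where
  even a b _ := Algebra.commutes (ε a) (g b)
  odd a b _ := by
    rw [AlgHom.comp_apply, AlgHom.comp_apply, hε]; exact Algebra.commutes (ε a) (g b)

/-- The homomorphism `ε ⊗ id`. -/
def counitLeftAlg (ε : A →ₐ[Ch] Ch) (hε : ∀ x, ε (parity A x) = ε x) : T2 A →ₐ[Ch] Compl A :=
  slift _ _ (superCommute_counit ε hε (toComplAlg A))

/-- The homomorphism `id ⊗ ε`. -/
def counitRightAlg (ε : A →ₐ[Ch] Ch) (hε : ∀ x, ε (parity A x) = ε x) : T2 A →ₐ[Ch] Compl A :=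
  slift _ _ (superCommute_counit ε hε (toComplAlg A)).symm

theorem counitLeftAlg_apply (ε : A →ₐ[Ch] Ch) (hε : ∀ x, ε (parity A x) = ε x) (x : T2 A) :
    counitLeftAlg ε hε x = convolve (unitCounit ε) LinearMap.id x := by
  refine LinearMap.congr_fun (Compl.linearMap_ext_stmul
    (f := (counitLeftAlg ε hε).toLinearMap) (g := convolve (unitCounit ε) LinearMap.id)
    fun a b => ?_) x
  refine (slift_stmul _ _ (superCommute_counit ε hε (toComplAlg A)) a b).trans ?_
  refine Eq.trans ?_ (convolve_tens _ _ a b).symm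
  rw [toCompl_mul]
  exact congrArg (· * toCompl b) (toCompl_algebraMap (ε a)).symm

theorem counitRightAlg_apply (ε : A →ₐ[Ch] Ch) (hε : ∀ x, ε (parity A x) = ε x) (x : T2 A) :
    counitRightAlg ε hε x = convolve LinearMap.id (unitCounit ε) x := by
  refine LinearMap.congr_fun (Compl.linearMap_ext_stmul
    (f := (counitRightAlg ε hε).toLinearMap) (g := convolve LinearMap.id (unitCounit ε))
    fun a b => ?_) x
  refine (slift_stmul _ _ (superCommute_counit ε hε (toComplAlg A)).symm a b).trans ?_
  refine Eq.trans ?_ (convolve_tens _ _ a b).symm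
  rw [toCompl_mul]
  exact congrArg (toCompl a * ·) (toCompl_algebraMap (ε b)).symm

theorem tens_add_left (a a' b : A) : tens (a + a') b = tens a b + tens a' b := by
  simp only [tens, stmul, GradedTensorProduct.tmul, add_tmul, map_add]

theorem tens_add_right (a b b' : A) : tens a (b + b') = tens a b + tens a b' := by
  simp only [tens, stmul, GradedTensorProduct.tmul, tmul_add, map_add]

theorem tens_mul_of_even (a : A) {b : A} (c d : A) (hb : parity A b = b) :
    tens a b * tens c d = tens (a * c) (b * d) := by
  rw [tens, tens, ← toCompl_mul, stmul_mul_of_even a c d hb]; rfl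

theorem tens_mul_of_odd (a : A) {b : A} (c d : A) (hb : parity A b = -b) :
    tens a b * tens c d = tens (a * parity A c) (b * d) := by
  rw [tens, tens, ← toCompl_mul, stmul_mul_of_odd a c d hb]; rfl

/-- Two linear maps of `T2 A` agree if they agree on tensors of homogeneous elements. -/
theorem linearMap_ext_tens {C : Type} [Ring C] [Algebra Ch C] {f g : T2 A →ₗ[Ch] Compl C}
    (h : ∀ a b : A, (parity A a = a ∨ parity A a = -a) → (parity A b = b ∨ parity A b = -b) →
      f (tens a b) = g (tens a b)) : f = g := by
  refine Compl.linearMap_ext_stmul fun a b => ?_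
  change f (tens a b) = g (tens a b)
  obtain ⟨a₀, a₁, h₀, h₁, rfl⟩ := exists_even_odd a
  obtain ⟨b₀, b₁, h₀', h₁', rfl⟩ := exists_even_odd b
  simp only [tens_add_left, tens_add_right, map_add, h a₀ b₀ (.inl h₀) (.inl h₀'),
    h a₀ b₁ (.inl h₀) (.inr h₁'), h a₁ b₀ (.inr h₁) (.inl h₀'), h a₁ b₁ (.inr h₁) (.inr h₁')]

variable {S : A →ₗ[Ch] A}

theorem antipode_mul_of_even_right
    (hS₀ : ∀ x y : A, parity A x = x → S (x * y) = S y * S x)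
    (hS₁ : ∀ x y : A, parity A x = -x → S (x * y) = S (parity A y) * S x)
    (x : A) {y : A} (hy : parity A y = y) : S (x * y) = S y * S x := by
  obtain ⟨u, v, hu, hv, rfl⟩ := exists_even_odd x
  rw [add_mul, map_add, hS₀ u y hu, hS₁ v y hv, hy, map_add, mul_add]

/-- In `m (S ⊗ id) ((a ⊗ b)(y ⊗ z))` the factor chosen homogeneous is `y`, on the right of `S (a
y)`, so the sign rule has to be available from that side too. -/
theorem antipode_mul_of_odd_right
    (hS₀ : ∀ x y : A, parity A x = x → S (x * y) = S y * S x)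
    (hS₁ : ∀ x y : A, parity A x = -x → S (x * y) = S (parity A y) * S x)
    (x : A) {y : A} (hy : parity A y = -y) : S (x * y) = S y * S (parity A x) := by
  obtain ⟨u, v, hu, hv, rfl⟩ := exists_even_odd x
  rw [add_mul, map_add, hS₀ u y hu, hS₁ v y hv, hy, map_add (parity A), hu, hv, map_add, mul_add,
    map_neg, map_neg, neg_mul, mul_neg]

/-- If `m (S ⊗ id) u` is a scalar, then `m (S ⊗ id) (u v)` is the product of this scalar and
`m (S ⊗ id) v`. -/
theorem convolve_antipode_left_mul
    (hS₀ : ∀ x y : A, parity A x = x → S (x * y) = S y * S x)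
    (hS₁ : ∀ x y : A, parity A x = -x → S (x * y) = S (parity A y) * S x)
    {u : T2 A} {c : Ch} (hu : convolve S LinearMap.id u = c • 1)
    (hu' : convolve S LinearMap.id (parity (T2 A) u) = c • 1) (v : T2 A) :
    convolve S LinearMap.id (u * v) = c • convolve S LinearMap.id v := by
  refine LinearMap.congr_fun (linearMap_ext_tens
    (f := convolve S LinearMap.id ∘ₗ LinearMap.mulLeft Ch u)
    (g := c • convolve S LinearMap.id) fun y z hy _ => ?_) v
  simp only [LinearMap.comp_apply, LinearMap.mulLeft_apply, LinearMap.smul_apply]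
  rcases hy with hy | hy
  -- For even `y`, `S(a y) b z = S(y) (S(a) b) z`: the left factor enters only through `m (S ⊗ id)`.
  · have key : convolve S LinearMap.id ∘ₗ LinearMap.mulRight Ch (tens y z)
        = LinearMap.mulRight Ch (toCompl z) ∘ₗ LinearMap.mulLeft Ch (toCompl (S y)) ∘ₗ
          convolve S LinearMap.id := by
      refine linearMap_ext_tens fun a b _ hb => ?_
      simp only [LinearMap.comp_apply, LinearMap.mulLeft_apply, LinearMap.mulRight_apply]
      have hab : tens a b * tens y z = tens (a * y) (b * z) := by
        rcases hb with hb | hb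
        · exact tens_mul_of_even a y z hb
        · rw [tens_mul_of_odd a y z hb, hy]
      rw [hab, convolve_tens, convolve_tens, antipode_mul_of_even_right hS₀ hS₁ a hy,
        ← toCompl_mul, ← toCompl_mul]
      simp only [LinearMap.id_apply, mul_assoc]
    have := LinearMap.congr_fun key u
    simp only [LinearMap.comp_apply, LinearMap.mulLeft_apply, LinearMap.mulRight_apply, hu] at this
    rw [this, mul_smul_comm, smul_mul_assoc, mul_one, convolve_tens, toCompl_mul]; rfl
  -- For odd `y` there are two signs, from `y` passing `b` and from reversing `S(a y)`. Their
  -- product `(-1)^(|a| + |b|)` replaces `u` by its image under parity, which is where `hu'` is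
  -- needed.
  · have key : convolve S LinearMap.id ∘ₗ LinearMap.mulRight Ch (tens y z)
        = LinearMap.mulRight Ch (toCompl z) ∘ₗ LinearMap.mulLeft Ch (toCompl (S y)) ∘ₗ
          convolve S LinearMap.id ∘ₗ (parity (T2 A)).toLinearMap := by
      refine linearMap_ext_tens fun a b _ hb => ?_
      simp only [LinearMap.comp_apply, LinearMap.mulLeft_apply, LinearMap.mulRight_apply,
        AlgHom.toLinearMap_apply, parity_tens]
      rw [convolve_tens, ← toCompl_mul, ← toCompl_mul]
      rcases hb with hb | hb
      · rw [tens_mul_of_even a y z hb, convolve_tens, antipode_mul_of_odd_right hS₀ hS₁ a hy, hb]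
        simp only [LinearMap.id_apply, mul_assoc]
      · rw [tens_mul_of_odd a y z hb, convolve_tens, hy, mul_neg, map_neg,
          antipode_mul_of_odd_right hS₀ hS₁ a hy, hb]
        simp only [LinearMap.id_apply, mul_assoc, neg_mul, mul_neg]
    have := LinearMap.congr_fun key u
    simp only [LinearMap.comp_apply, LinearMap.mulLeft_apply, LinearMap.mulRight_apply,
      AlgHom.toLinearMap_apply, hu'] at this
    rw [this, mul_smul_comm, smul_mul_assoc, mul_one, convolve_tens, toCompl_mul]; rfl

/-- If `m (id ⊗ S) v` is a scalar, then `m (id ⊗ S) (u v)` is the product of this scalar and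
`m (id ⊗ S) u`. -/
theorem convolve_antipode_right_mul
    (hS₀ : ∀ x y : A, parity A x = x → S (x * y) = S y * S x)
    (hS₁ : ∀ x y : A, parity A x = -x → S (x * y) = S (parity A y) * S x)
    {v : T2 A} {c : Ch} (hv : convolve LinearMap.id S v = c • 1)
    (hv' : convolve LinearMap.id S (parity (T2 A) v) = c • 1) (u : T2 A) :
    convolve LinearMap.id S (u * v) = c • convolve LinearMap.id S u := by
  refine LinearMap.congr_fun (linearMap_ext_tens
    (f := convolve LinearMap.id S ∘ₗ LinearMap.mulRight Ch v)
    (g := c • convolve LinearMap.id S) fun a b _ hb => ?_) u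
  simp only [LinearMap.comp_apply, LinearMap.mulRight_apply, LinearMap.smul_apply]
  rcases hb with hb | hb
  · have key : convolve LinearMap.id S ∘ₗ LinearMap.mulLeft Ch (tens a b)
        = LinearMap.mulRight Ch (toCompl (S b)) ∘ₗ LinearMap.mulLeft Ch (toCompl a) ∘ₗ
          convolve LinearMap.id S := by
      refine linearMap_ext_tens fun y z _ _ => ?_
      simp only [LinearMap.comp_apply, LinearMap.mulLeft_apply, LinearMap.mulRight_apply]
      rw [tens_mul_of_even a y z hb, convolve_tens, convolve_tens, hS₀ b z hb,
        ← toCompl_mul, ← toCompl_mul]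
      simp only [LinearMap.id_apply, mul_assoc]
    have := LinearMap.congr_fun key v
    simp only [LinearMap.comp_apply, LinearMap.mulLeft_apply, LinearMap.mulRight_apply, hv] at this
    rw [this, mul_smul_comm, smul_mul_assoc, mul_one, convolve_tens, toCompl_mul]; rfl
  -- For odd `b` the signs fall on `y` and on `z`, giving the parity of `v` and hence the use of
  -- `hv'`.
  · have key : convolve LinearMap.id S ∘ₗ LinearMap.mulLeft Ch (tens a b)
        = LinearMap.mulRight Ch (toCompl (S b)) ∘ₗ LinearMap.mulLeft Ch (toCompl a) ∘ₗ
          convolve LinearMap.id S ∘ₗ (parity (T2 A)).toLinearMap := by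
      refine linearMap_ext_tens fun y z _ _ => ?_
      simp only [LinearMap.comp_apply, LinearMap.mulLeft_apply, LinearMap.mulRight_apply,
        AlgHom.toLinearMap_apply, parity_tens]
      rw [tens_mul_of_odd a y z hb, convolve_tens, convolve_tens, hS₁ b z hb,
        ← toCompl_mul, ← toCompl_mul]
      simp only [LinearMap.id_apply, mul_assoc]
    have := LinearMap.congr_fun key v
    simp only [LinearMap.comp_apply, LinearMap.mulLeft_apply, LinearMap.mulRight_apply,
      AlgHom.toLinearMap_apply, hv'] at this
    rw [this, mul_smul_comm, smul_mul_assoc, mul_one, convolve_tens, toCompl_mul]; rfl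

end Convolution

namespace U

/-! ### The Hopf superalgebra axioms -/

/-- The exponential of an even primitive element is grouplike, since its two copies commute. -/
theorem comul_hExp {x : U} (hx : parity U x = x) (h : comul x = in1 U x + in2 U x) :
    comul (hExp x) = in1 U (hExp x) * in2 U (hExp x) := by
  rw [map_hExp, h, hExp_add, map_hExp, map_hExp]
  exact (superCommute_in U).even x x hx

theorem comul_K : comul K = in1 U K * in2 U K :=
  comul_hExp (by rw [map_add, parity_H1, parity_H2])
    (by rw [map_add, comul_H1, comul_H2, map_add, map_add]; abel)

theorem comul_Kinv : comul Kinv = in1 U Kinv * in2 U Kinv :=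
  comul_hExp (by rw [map_neg, map_add, parity_H1, parity_H2])
    (by simp only [map_neg, map_add, comul_H1, comul_H2]; abel)

theorem comul_coassoc (x : U) :
    coprodLeft comul (comul x) = coprodRight comul (comul x) := by
  have h : (coprodLeftAlg comul comul_parity).comp comul
      = (coprodRightAlg comul comul_parity).comp comul := by
    apply algHom_ext <;>
    simp only [AlgHom.comp_apply, comul_E, comul_F, comul_H1, comul_H2, comul_K, comul_Kinv,
      map_add, map_mul, coprodLeftAlg_in1, coprodLeftAlg_in2, coprodRightAlg_in1,
      coprodRightAlg_in2, leg12Alg_in1, leg12Alg_in2, leg23Alg_in1, leg23Alg_in2, add_mul, mul_add,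
      mul_assoc, add_assoc]
  rw [← coprodLeftAlg_apply comul comul_parity, ← coprodRightAlg_apply comul comul_parity]
  exact AlgHom.congr_fun h x

theorem counit_left (x : U) :
    convolve (unitCounit counit) LinearMap.id (comul x) = toCompl x := by
  have h : (counitLeftAlg counit counit_parity).comp comul = toComplAlg U := by
    have h1 : ∀ a, counitLeftAlg counit counit_parity (in1 U a) = algebraMap Ch _ (counit a) :=
      fun a => by
        rw [counitLeftAlg_apply, convolve_in1 _ _ rfl]; exact toCompl_algebraMap _
    have h2 : ∀ a, counitLeftAlg counit counit_parity (in2 U a) = toCompl a := fun a => by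
      rw [counitLeftAlg_apply, convolve_in2 _ _ (unitCounit_one _)]; rfl
    apply algHom_ext <;>
    simp only [AlgHom.comp_apply, comul_E, comul_F, comul_H1, comul_H2, map_add, map_mul, h1, h2,
      counit_E, counit_F, counit_H1, counit_H2, counit_K, map_zero, map_one, zero_mul, one_mul,
      zero_add, toComplAlg_apply]
  rw [← counitLeftAlg_apply counit counit_parity]
  exact AlgHom.congr_fun h x

theorem counit_right (x : U) :
    convolve LinearMap.id (unitCounit counit) (comul x) = toCompl x := by
  have h : (counitRightAlg counit counit_parity).comp comul = toComplAlg U := by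
    have h1 : ∀ a, counitRightAlg counit counit_parity (in2 U a) = algebraMap Ch _ (counit a) :=
      fun a => by
        rw [counitRightAlg_apply, convolve_in2 _ _ rfl]; exact toCompl_algebraMap _
    have h2 : ∀ a, counitRightAlg counit counit_parity (in1 U a) = toCompl a := fun a => by
      rw [counitRightAlg_apply, convolve_in1 _ _ (unitCounit_one _)]; rfl
    apply algHom_ext <;>
    simp only [AlgHom.comp_apply, comul_E, comul_F, comul_H1, comul_H2, map_add, map_mul, h1, h2,
      counit_E, counit_F, counit_H1, counit_H2, counit_Kinv, map_zero, map_one, mul_zero, mul_one,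
      add_zero, toComplAlg_apply]
  rw [← counitRightAlg_apply counit counit_parity]
  exact AlgHom.congr_fun h x

theorem convolve_antipode_left_generators (g : Gen) :
    convolve antipode LinearMap.id (comul (ofGen g)) = counit (ofGen g) • 1 := by
  have hE : convolve antipode LinearMap.id (comul E) = counit E • 1 := by
    rw [comul_E, counit_E, map_add, in1_mul_in2, convolve_tens, convolve_in2 _ _ antipode_one,
      antipode_E, ← map_add, LinearMap.id_apply, LinearMap.id_apply, neg_mul, mul_assoc,
      K_mul_Kinv, mul_one, neg_add_cancel, map_zero, zero_smul]
  have hF : convolve antipode LinearMap.id (comul F) = counit F • 1 := by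
    rw [comul_F, counit_F, map_add, in1_mul_in2, convolve_tens, convolve_in1 _ _ rfl,
      antipode_F, ← map_add, LinearMap.id_apply, antipode_K, neg_add_cancel, map_zero, zero_smul]
  have h1 : convolve antipode LinearMap.id (comul H1) = counit H1 • 1 := by
    rw [comul_H1, counit_H1, map_add, convolve_in2 _ _ antipode_one, convolve_in1 _ _ rfl,
      antipode_H1, ← map_add, LinearMap.id_apply, neg_add_cancel, map_zero, zero_smul]
  have h2 : convolve antipode LinearMap.id (comul H2) = counit H2 • 1 := by
    rw [comul_H2, counit_H2, map_add, convolve_in2 _ _ antipode_one, convolve_in1 _ _ rfl,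
      antipode_H2, ← map_add, LinearMap.id_apply, neg_add_cancel, map_zero, zero_smul]
  cases g
  exacts [hE, hF, h1, h2]

theorem convolve_antipode_right_generators (g : Gen) :
    convolve LinearMap.id antipode (comul (ofGen g)) = counit (ofGen g) • 1 := by
  have hE : convolve LinearMap.id antipode (comul E) = counit E • 1 := by
    rw [comul_E, counit_E, map_add, in1_mul_in2, convolve_tens, convolve_in2 _ _ rfl,
      antipode_E, ← map_add, LinearMap.id_apply, antipode_Kinv, add_neg_cancel, map_zero, zero_smul]
  have hF : convolve LinearMap.id antipode (comul F) = counit F • 1 := by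
    rw [comul_F, counit_F, map_add, in1_mul_in2, convolve_tens, convolve_in1 _ _ antipode_one,
      antipode_F, ← map_add, LinearMap.id_apply, LinearMap.id_apply, mul_neg, ← mul_assoc,
      K_mul_Kinv, one_mul, add_neg_cancel, map_zero, zero_smul]
  have h1 : convolve LinearMap.id antipode (comul H1) = counit H1 • 1 := by
    rw [comul_H1, counit_H1, map_add, convolve_in2 _ _ rfl, convolve_in1 _ _ antipode_one,
      antipode_H1, ← map_add, LinearMap.id_apply, add_neg_cancel, map_zero, zero_smul]
  have h2 : convolve LinearMap.id antipode (comul H2) = counit H2 • 1 := by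
    rw [comul_H2, counit_H2, map_add, convolve_in2 _ _ rfl, convolve_in1 _ _ antipode_one,
      antipode_H2, ← map_add, LinearMap.id_apply, add_neg_cancel, map_zero, zero_smul]
  cases g
  exacts [hE, hF, h1, h2]

/-- A linear functional of `Δ(x)` which is multiplicative where it agrees with the counit and agrees
with it on the generators is the counit. -/
theorem eq_counit_of_generators (φ : T2 U →ₗ[Ch] Compl U) (hone : φ 1 = 1)
    (hgen : ∀ g, φ (comul (ofGen g)) = counit (ofGen g) • 1)
    (hmul : ∀ x y : U, φ (comul x) = counit x • 1 → φ (parity (T2 U) (comul x)) = counit x • 1 →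
      φ (comul y) = counit y • 1 → φ (parity (T2 U) (comul y)) = counit y • 1 →
      φ (comul x * comul y) = (counit x * counit y) • 1) (x : U) :
    φ (comul x) = counit x • 1 := by
  -- The multiplicativity hypothesis also asks for the value at the parity image of `Δ(x)`, so the
  -- induction carries both statements.
  let P : U → Prop := fun x =>
    φ (comul x) = counit x • 1 ∧ φ (comul (parity U x)) = counit (parity U x) • 1
  have hPmul : ∀ x y, P x → P y → P (x * y) := by
    intro x y hx hy
    have hx2 := hx.2
    have hy2 := hy.2
    rw [comul_parity, counit_parity] at hx2 hy2
    refine ⟨?_, ?_⟩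
    · rw [map_mul comul, map_mul counit]
      exact hmul x y hx.1 hx2 hy.1 hy2
    · rw [map_mul (parity U), map_mul comul, map_mul counit]
      refine hmul _ _ hx.2 ?_ hy.2 ?_
      · rw [← comul_parity, Superalgebra.parity_parity, counit_parity]; exact hx.1
      · rw [← comul_parity, Superalgebra.parity_parity, counit_parity]; exact hy.1
  have hP : ∀ a : FreeAlg, P (ofFree a) := by
    intro a
    induction a using FreeAlgebra.induction with
    | grade0 r =>
      have : ∀ r : Ch, φ (comul (algebraMap Ch U r)) = counit (algebraMap Ch U r) • 1 := fun r => by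
        rw [AlgHom.commutes, AlgHom.commutes, Algebra.algebraMap_eq_smul_one, map_smul, hone]; rfl
      refine ⟨?_, ?_⟩
      · rw [AlgHom.commutes]; exact this r
      · rw [AlgHom.commutes, AlgHom.commutes]; exact this r
    | grade1 g =>
      rw [ofFree_ι]
      refine ⟨hgen g, ?_⟩
      rw [parity_ofGen, map_smul, map_smul, map_smul, hgen, smul_assoc]
    | mul a b ha hb => rw [map_mul]; exact hPmul _ _ ha hb
    | add a b ha hb =>
      refine ⟨?_, ?_⟩
      · rw [map_add, map_add, map_add, map_add, ha.1, hb.1, add_smul]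
      · rw [map_add, map_add, map_add, map_add, map_add, ha.2, hb.2, add_smul]
  exact LinearMap.congr_fun (linearMap_ext (f := φ ∘ₗ comul.toLinearMap)
    (g := counit.toLinearMap.smulRight (1 : Compl U)) fun a => (hP a).1) x

theorem toCompl_unitCounit (x : U) : toCompl (unitCounit counit x) = counit x • (1 : Compl U) := by
  refine (toCompl_algebraMap (A := U) (counit x)).trans ?_
  rw [Algebra.algebraMap_eq_smul_one]

theorem antipode_left (x : U) :
    convolve antipode LinearMap.id (comul x) = toCompl (unitCounit counit x) := by
  rw [toCompl_unitCounit]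
  refine eq_counit_of_generators _ ?_ convolve_antipode_left_generators ?_ x
  · rw [← map_one (in1 U), convolve_in1 _ _ rfl, antipode_one]; rfl
  · intro x y hx hx' hy _
    rw [convolve_antipode_left_mul (fun x y hx => antipode_mul_of_even y hx)
      (fun x y hx => antipode_mul_of_odd y hx) hx hx', hy, smul_smul]

theorem antipode_right (x : U) :
    convolve LinearMap.id antipode (comul x) = toCompl (unitCounit counit x) := by
  rw [toCompl_unitCounit]
  refine eq_counit_of_generators _ ?_ convolve_antipode_right_generators ?_ x
  · rw [← map_one (in1 U), convolve_in1 _ _ antipode_one]; rfl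
  · intro x y hx _ hy hy'
    rw [convolve_antipode_right_mul (fun x y hx => antipode_mul_of_even y hx)
      (fun x y hx => antipode_mul_of_odd y hx) hy hy', hx, smul_smul, mul_comm]

theorem isHopfSuperalgebra : IsHopfSuperalgebra comul counit antipode where
  complete := inferInstance
  comul_even := comul_parity
  counit_even := counit_parity
  antipode_even := antipode_parity
  coassoc := comul_coassoc
  counit_left := counit_left
  counit_right := counit_right
  antipode_left := antipode_left
  antipode_right := antipode_right

theorem isStructureMaps : IsStructureMaps comul counit antipode where
  comul_E := by rw [comul_E, in1_mul_in2, in2_eq_tens]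
  comul_F := by rw [comul_F, in1_mul_in2, in1_eq_tens]
  comul_H1 := comul_H1
  comul_H2 := comul_H2
  counit_E := counit_E
  counit_F := counit_F
  counit_H1 := counit_H1
  counit_H2 := counit_H2
  antipode_E := antipode_E
  antipode_F := antipode_F
  antipode_H1 := antipode_H1
  antipode_H2 := antipode_H2
  antipode_one := antipode_one
  antipode_mul := antipode_mul

theorem isStructureMaps_unique {Δ : U →ₐ[Ch] T2 U} {ε : U →ₐ[Ch] Ch} {S : U →ₗ[Ch] U}
    (h : IsStructureMaps Δ ε S) : Δ = comul ∧ ε = counit ∧ S = antipode := by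
  have h' := isStructureMaps
  refine ⟨algHom_ext ?_ ?_ ?_ ?_, algHom_ext_of_complete ?_ ?_ ?_ ?_,
    antipode_unique S h.antipode_E h.antipode_F h.antipode_H1 h.antipode_H2 h.antipode_one
      h.antipode_mul⟩
  · rw [h.comul_E, h'.comul_E]
  · rw [h.comul_F, h'.comul_F]
  · rw [h.comul_H1, h'.comul_H1]
  · rw [h.comul_H2, h'.comul_H2]
  · rw [h.counit_E, h'.counit_E]
  · rw [h.counit_F, h'.counit_F]
  · rw [h.counit_H1, h'.counit_H1]
  · rw [h.counit_H2, h'.counit_H2]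

end U

/-! ### Identities for the `R`-matrix -/

section RMatrixIdentities

variable {R : Type} [Ring R]

/-- Here `h`, `h'` are `H_1`, `H_2` in the leg of `x = E` and `g`, `g'` are those of the other leg.
The weights `1, -1` and the minus sign in the exponent combine to the shift `g + g'`, whose
exponential is `K` in the other leg. -/
theorem raising_identity {x h h' g g' : R} (hx : h * x = x * h + x) (hx' : h' * x = x * h' - x)
    (hg : g * x = x * g) (hg' : g' * x = x * g') :
    (h * g - h' * g') * x = x * ((g + g') + (h * g - h' * g')) := by
  simp only [sub_mul, mul_assoc, hg, hg', mul_mul_of_mul_eq hx, mul_mul_of_mul_eq hx', add_mul,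
    mul_add, mul_sub]
  abel

theorem lowering_identity {x h h' g g' : R} (hx : h * x = x * h - x) (hx' : h' * x = x * h' + x)
    (hg : g * x = x * g) (hg' : g' * x = x * g') :
    (h * g - h' * g') * x = x * (-(g + g') + (h * g - h' * g')) := by
  simp only [sub_mul, mul_assoc, hg, hg', mul_mul_of_mul_eq hx, mul_mul_of_mul_eq hx', add_mul,
    mul_add, mul_sub, neg_add, mul_neg]
  abel

variable [Algebra Ch R]

/-- All terms containing `e₂` twice vanish, and what is left is `hs` multiplied by `e₂` on the
right. -/
theorem intertwines_E_identity {s : Ch} {e₁ f₁ k₁ l₁ e₂ : R} (hs : s • (e₁ * f₁ + f₁ * e₁) = k₁ - l₁)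
    (h₂ : e₂ * e₂ = 0) (hk : e₂ * k₁ = k₁ * e₂) (hl : e₂ * l₁ = l₁ * e₂)
    (hf : e₂ * f₁ = -(f₁ * e₂)) (he : e₂ * e₁ = -(e₁ * e₂)) :
    (1 + s • (f₁ * e₂)) * (e₁ + e₂ * k₁) = (e₂ * l₁ + e₁) * (1 + s • (f₁ * e₂)) := by
  have hs' : k₁ * e₂ = l₁ * e₂ + s • (e₁ * (f₁ * e₂)) + s • (f₁ * (e₁ * e₂)) := by
    have := congrArg (· * e₂) hs
    simp only [smul_add, add_mul, sub_mul, smul_mul_assoc, mul_assoc] at this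
    rw [add_assoc, this]
    abel
  simp only [mul_add, add_mul, one_mul, mul_one, smul_mul_assoc, mul_smul_comm, mul_assoc, he, hk,
    hl, mul_mul_of_mul_eq hf, mul_mul_of_mul_eq hk, h₂, mul_neg,
    neg_mul, mul_zero, smul_zero, smul_neg, smul_add, neg_zero]
  rw [hs']
  abel

theorem intertwines_F_identity {s : Ch} {f₁ e₂ f₂ k₂ l₂ : R}
    (hs : s • (e₂ * f₂ + f₂ * e₂) = k₂ - l₂) (h₁ : f₁ * f₁ = 0) (hk : k₂ * f₁ = f₁ * k₂)
    (he : e₂ * f₁ = -(f₁ * e₂)) (hf : f₂ * f₁ = -(f₁ * f₂)) :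
    (1 + s • (f₁ * e₂)) * (f₁ * l₂ + f₂) = (f₂ + k₂ * f₁) * (1 + s • (f₁ * e₂)) := by
  have hs' : f₁ * k₂ = f₁ * l₂ + s • (f₁ * (e₂ * f₂)) + s • (f₁ * (f₂ * e₂)) := by
    have := congrArg (f₁ * ·) hs
    simp only [smul_add, mul_add, mul_sub, mul_smul_comm] at this
    rw [add_assoc, this]
    abel
  simp only [mul_add, add_mul, one_mul, mul_one, smul_mul_assoc, mul_smul_comm, mul_assoc, hk,
    mul_mul_of_mul_eq he, mul_mul_of_mul_eq hf, mul_mul_of_mul_eq hk, mul_mul_of_mul_eq h₁,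
    zero_mul, neg_mul, mul_neg, smul_zero, smul_neg, smul_add, neg_zero]
  rw [hs']
  abel

theorem commute_weight_zero_identity {f₁ e₂ h₁ h₂ : R} {c : Ch} (hf : h₁ * f₁ = f₁ * h₁ - c • f₁)
    (he : h₂ * e₂ = e₂ * h₂ + c • e₂) (hfe : h₂ * f₁ = f₁ * h₂) (hef : h₁ * e₂ = e₂ * h₁) :
    Commute (h₁ + h₂) (f₁ * e₂) := by
  rw [Commute, SemiconjBy]
  simp only [add_mul, mul_add, mul_assoc, mul_mul_of_mul_eq hf, mul_mul_of_mul_eq hfe, he, hef,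
    sub_mul, smul_mul_assoc, mul_smul_comm]
  abel

/-- Moving `u = Υ₁₃` to the right past the second `Θ` turns `f₂ e₃` into `k₁ f₂ e₃`. The two factors
then multiply to `1 + s (f₁ + k₁ f₂) e₃`, the quadratic term vanishing by `e₃² = 0`. -/
theorem comul_left_identity {s : Ch} {f₁ k₁ f₂ e₃ u v : R} (hu : u * e₃ = e₃ * k₁ * u)
    (huf : u * f₂ = f₂ * u) (h₃ : e₃ * e₃ = 0) (hf : e₃ * f₂ = -(f₂ * e₃)) (hk : e₃ * k₁ = k₁ * e₃)
    (hfk : f₂ * k₁ = k₁ * f₂) :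
    (1 + s • ((f₁ + k₁ * f₂) * e₃)) * (u * v)
      = (1 + s • (f₁ * e₃)) * u * ((1 + s • (f₂ * e₃)) * v) := by
  have h : u * (1 + s • (f₂ * e₃)) = (1 + s • (k₁ * f₂ * e₃)) * u := by
    rw [mul_add, add_mul, mul_one, one_mul, mul_smul_comm, smul_mul_assoc, ← mul_assoc, huf,
      mul_assoc, hu, ← mul_assoc, hk, ← mul_assoc, hfk]
  have h' : (1 + s • (f₁ * e₃)) * (1 + s • (k₁ * f₂ * e₃)) = 1 + s • ((f₁ + k₁ * f₂) * e₃) := by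
    have h0 : f₁ * e₃ * (k₁ * f₂ * e₃) = 0 := by
      rw [mul_assoc, mul_assoc k₁, mul_mul_of_mul_eq hk, mul_assoc, mul_mul_of_mul_eq hf, neg_mul,
        mul_assoc, h₃, mul_zero, neg_zero, mul_zero, mul_zero]
    rw [mul_add, mul_one, add_mul, one_mul, smul_mul_smul_comm, h0, smul_zero, add_zero, add_mul,
      smul_add, add_assoc]
  rw [← h', mul_assoc (1 + s • (f₁ * e₃)), mul_assoc (1 + s • (f₁ * e₃)), ← mul_assoc u (1 + _), h,
    mul_assoc _ u]

/-- Now `Υ₁₃` passing `f₁` creates the `l₃` of `e₂ l₃ + e₃`, and the quadratic term vanishes by `f₁²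
= 0`. -/
theorem comul_right_identity {s : Ch} {f₁ e₂ e₃ l₃ u v : R} (hu : u * f₁ = f₁ * l₃ * u)
    (hue : u * e₂ = e₂ * u) (h₁ : f₁ * f₁ = 0) (hf : e₃ * f₁ = -(f₁ * e₃))
    (hl : l₃ * e₂ = e₂ * l₃) :
    (1 + s • (f₁ * (e₂ * l₃ + e₃))) * (u * v)
      = (1 + s • (f₁ * e₃)) * u * ((1 + s • (f₁ * e₂)) * v) := by
  have h : u * (1 + s • (f₁ * e₂)) = (1 + s • (f₁ * (e₂ * l₃))) * u := by
    rw [mul_add, add_mul, mul_one, one_mul, mul_smul_comm, smul_mul_assoc, ← mul_assoc, hu,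
      mul_assoc, hue, ← mul_assoc, mul_assoc f₁, hl]
  have h' : (1 + s • (f₁ * e₃)) * (1 + s • (f₁ * (e₂ * l₃))) = 1 + s • (f₁ * (e₂ * l₃ + e₃)) := by
    have h0 : f₁ * e₃ * (f₁ * (e₂ * l₃)) = 0 := by
      rw [mul_assoc, mul_mul_of_mul_eq hf, neg_mul, mul_assoc, mul_neg, mul_mul_of_mul_eq h₁,
        zero_mul, neg_zero]
    rw [mul_add, mul_one, add_mul, one_mul, smul_mul_smul_comm, h0, smul_zero, add_zero, mul_add,
      smul_add]
    abel
  rw [← h', mul_assoc (1 + s • (f₁ * e₃)), mul_assoc (1 + s • (f₁ * e₃)), ← mul_assoc u (1 + _), h,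
    mul_assoc _ u]

end RMatrixIdentities

/-! ### Invertibility of the `R`-matrix and the intertwining property -/

namespace U

theorem Upsilon_eq : Upsilon = hExp (in1 U H1 * in2 U H1 - in1 U H2 * in2 U H2) := by
  rw [Upsilon, in1_mul_in2, in1_mul_in2]

theorem Upsilon_eq' : Upsilon = hExp (in2 U H1 * in1 U H1 - in2 U H2 * in1 U H2) := by
  rw [Upsilon_eq, in2_mul_in1_of_even H1 parity_H1, in2_mul_in1_of_even H2 parity_H2]

theorem Theta_eq : Theta = 1 + (q - q⁻¹) • (in1 U F * in2 U E) := by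
  rw [Theta, in1_mul_in2]

/-- An element commuting with all `H_i ⊗ 1` and `1 ⊗ H_i` commutes with the exponent of `Υ`. -/
theorem commute_exponent {x : T2 U} (h1 : Commute x (in1 U H1)) (h2 : Commute x (in1 U H2))
    (h1' : Commute x (in2 U H1)) (h2' : Commute x (in2 U H2)) :
    Commute x (in1 U H1 * in2 U H1 - in1 U H2 * in2 U H2) :=
  (h1.mul_right h1').sub_right (h2.mul_right h2')

theorem commute_in1_exponent {x : U} (h1 : Commute x H1) (h2 : Commute x H2) :
    Commute (in1 U x) (in1 U H1 * in2 U H1 - in1 U H2 * in2 U H2) :=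
  commute_exponent (h1.map _) (h2.map _) ((superCommute_in U).even _ _ parity_H1)
    ((superCommute_in U).even _ _ parity_H2)

theorem commute_in2_exponent {x : U} (h1 : Commute x H1) (h2 : Commute x H2) :
    Commute (in2 U x) (in1 U H1 * in2 U H1 - in1 U H2 * in2 U H2) :=
  commute_exponent ((superCommute_in U).symm.even _ _ parity_H1)
    ((superCommute_in U).symm.even _ _ parity_H2) (h1.map _) (h2.map _)

theorem commute_in1_Upsilon {x : U} (h1 : Commute x H1) (h2 : Commute x H2) :
    Commute (in1 U x) Upsilon := by
  rw [Upsilon_eq]; exact (commute_in1_exponent h1 h2).hExp_right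

theorem commute_in2_Upsilon {x : U} (h1 : Commute x H1) (h2 : Commute x H2) :
    Commute (in2 U x) Upsilon := by
  rw [Upsilon_eq]; exact (commute_in2_exponent h1 h2).hExp_right

theorem in1_Kinv : in1 U Kinv = hExp (-(in1 U H1 + in1 U H2)) := by
  rw [Kinv, map_hExp, map_neg, map_add]

theorem in2_K : in2 U K = hExp (in2 U H1 + in2 U H2) := by rw [K, map_hExp, map_add]

theorem exponent_comm : in1 U H1 * in2 U H1 - in1 U H2 * in2 U H2
    = in2 U H1 * in1 U H1 - in2 U H2 * in1 U H2 := by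
  rw [in2_mul_in1_of_even H1 parity_H1, in2_mul_in1_of_even H2 parity_H2]

theorem Upsilon_mul_in1_E : Upsilon * in1 U E = in1 U E * in2 U K * Upsilon := by
  rw [Upsilon_eq, in2_K]
  refine hExp_mul_of_comm (raising_identity relations_in1.h₁_mul_e relations_in1.h₂_mul_e
    (in2_mul_in1_of_even E parity_H1) (in2_mul_in1_of_even E parity_H2)) ?_
  rw [← map_add]
  exact commute_in2_exponent relations.commute_h₁ relations.commute_h₂

theorem Upsilon_mul_in1_F : Upsilon * in1 U F = in1 U F * in2 U Kinv * Upsilon := by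
  rw [Upsilon_eq, in2_Kinv]
  refine hExp_mul_of_comm (lowering_identity relations_in1.h₁_mul_f relations_in1.h₂_mul_f
    (in2_mul_in1_of_even F parity_H1) (in2_mul_in1_of_even F parity_H2)) ?_
  rw [← map_add]
  exact (commute_in2_exponent relations.commute_h₁ relations.commute_h₂).neg_left

theorem Upsilon_mul_in2_E : Upsilon * in2 U E = in2 U E * in1 U K * Upsilon := by
  rw [Upsilon_eq', in1_K]
  refine hExp_mul_of_comm (raising_identity relations_in2.h₁_mul_e relations_in2.h₂_mul_e
    (in2_mul_in1_of_even' E parity_H1).symm (in2_mul_in1_of_even' E parity_H2).symm) ?_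
  rw [← map_add, ← exponent_comm]
  exact commute_in1_exponent relations.commute_h₁ relations.commute_h₂

theorem Upsilon_mul_in2_F : Upsilon * in2 U F = in2 U F * in1 U Kinv * Upsilon := by
  rw [Upsilon_eq', in1_Kinv]
  refine hExp_mul_of_comm (lowering_identity relations_in2.h₁_mul_f relations_in2.h₂_mul_f
    (in2_mul_in1_of_even' F parity_H1).symm (in2_mul_in1_of_even' F parity_H2).symm) ?_
  rw [← map_add, ← exponent_comm]
  exact (commute_in1_exponent relations.commute_h₁ relations.commute_h₂).neg_left

/-- `F ⊗ E` squares to zero because `E` does. -/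
theorem isUnit_Theta : IsUnit Theta := by
  have hn : in1 U F * in2 U E * (in1 U F * in2 U E) = 0 := by
    rw [mul_assoc, ← mul_assoc (in2 U E), in2_mul_in1_of_odd parity_F parity_E, neg_mul, mul_assoc,
      relations_in2.EE, mul_zero, neg_zero, mul_zero]
  rw [Theta_eq]
  refine IsNilpotent.isUnit_one_add ⟨2, ?_⟩
  rw [pow_two, smul_mul_smul_comm, hn, smul_zero]

theorem isUnit_R : IsUnit R := isUnit_Theta.mul (isUnit_hExp _)

theorem smul_EF : (q - q⁻¹) • (E * F + F * E) = K - Kinv := by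
  rw [relations.EF, smul_bracket]; rfl

/-- Conjugation by `Υ` takes `Δ(E)` to `E ⊗ 1 + K ⊗ E`, which differs from the opposite coproduct
only in having `K` for `K⁻¹`; correcting this is left to `Θ`. -/
theorem Upsilon_mul_comul_E :
    Upsilon * comul E = (in1 U E + in2 U E * in1 U K) * Upsilon := by
  rw [comul_E, mul_add, ← mul_assoc, Upsilon_mul_in1_E, mul_assoc _ Upsilon,
    ← (commute_in2_Upsilon commute_Kinv_H1 commute_Kinv_H2).eq, ← mul_assoc, mul_assoc (in1 U E),
    ← map_mul, K_mul_Kinv, map_one, mul_one, Upsilon_mul_in2_E, add_mul]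

theorem Upsilon_mul_comul_F :
    Upsilon * comul F = (in1 U F * in2 U Kinv + in2 U F) * Upsilon := by
  rw [comul_F, mul_add, Upsilon_mul_in1_F, ← mul_assoc Upsilon,
    ← (commute_in1_Upsilon commute_K_H1 commute_K_H2).eq, mul_assoc (in1 U K), Upsilon_mul_in2_F,
    mul_assoc (in2 U F), ← mul_assoc (in1 U K), ← in2_mul_in1_of_even' F parity_K,
    mul_assoc (in2 U F), ← mul_assoc (in1 U K), ← map_mul, K_mul_Kinv, map_one, one_mul, add_mul]

theorem flip_comul_E : flipAlg U (comul E) = in2 U E * in1 U Kinv + in1 U E := by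
  rw [comul_E, map_add, map_mul]
  simp only [flipAlg_apply, flip_in1, flip_in2]

theorem flip_comul_F : flipAlg U (comul F) = in2 U F + in2 U K * in1 U F := by
  rw [comul_F, map_add, map_mul]
  simp only [flipAlg_apply, flip_in1, flip_in2]

theorem intertwines_E : R * comul E = flipAlg U (comul E) * R := by
  rw [R, mul_assoc, Upsilon_mul_comul_E, ← mul_assoc, ← mul_assoc, flip_comul_E, Theta_eq]
  congr 1
  refine intertwines_E_identity ?_ relations_in2.EE (in2_mul_in1_of_even' E parity_K)
    (in2_mul_in1_of_even' E parity_Kinv) (in2_mul_in1_of_odd parity_F parity_E)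
    (in2_mul_in1_of_odd parity_E parity_E)
  rw [← map_mul, ← map_mul, ← map_add, ← map_smul, smul_EF, map_sub]

theorem intertwines_F : R * comul F = flipAlg U (comul F) * R := by
  rw [R, mul_assoc, Upsilon_mul_comul_F, ← mul_assoc, ← mul_assoc, flip_comul_F, Theta_eq]
  congr 1
  refine intertwines_F_identity ?_ relations_in1.FF (in2_mul_in1_of_even F parity_K)
    (in2_mul_in1_of_odd parity_F parity_E) (in2_mul_in1_of_odd parity_F parity_F)
  rw [← map_mul, ← map_mul, ← map_add, ← map_smul, smul_EF, map_sub]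

/-- `F ⊗ E` has total weight zero, and the exponent of `Υ` involves only elements commuting with
`h`. The weight `c` is `1` for `H_1` and `-1` for `H_2`. -/
theorem commute_R_of_commute {h : U} (hh : parity U h = h) (h1 : Commute h H1) (h2 : Commute h H2)
    {c : Ch} (hE : h * E = E * h + c • E) (hF : h * F = F * h - c • F) :
    R * (in1 U h + in2 U h) = (in1 U h + in2 U h) * R := by
  have hn : Commute (in1 U h + in2 U h) (in1 U F * in2 U E) := by
    refine commute_weight_zero_identity (c := c) ?_ ?_ (in2_mul_in1_of_even F hh)
      (in2_mul_in1_of_even' E hh).symm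
    · rw [← map_mul, hF, map_sub, map_smul, map_mul]
    · rw [← map_mul, hE, map_add, map_smul, map_mul]
  have hT : Commute (in1 U h + in2 U h) Theta := by
    rw [Theta_eq]
    exact (Commute.one_right _).add_right (hn.smul_right _)
  exact (hT.mul_right ((commute_in1_Upsilon h1 h2).add_left (commute_in2_Upsilon h1 h2))).symm.eq

theorem intertwines_H1 : R * comul H1 = flipAlg U (comul H1) * R := by
  rw [comul_H1, map_add, flipAlg_apply, flipAlg_apply, flip_in1, flip_in2, add_comm (in2 U H1)]
  exact commute_R_of_commute parity_H1 (Commute.refl _) relations.HH (c := 1)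
    (by rw [one_smul, relations.h₁_mul_e]) (by rw [one_smul, relations.h₁_mul_f])

theorem intertwines_H2 : R * comul H2 = flipAlg U (comul H2) * R := by
  rw [comul_H2, map_add, flipAlg_apply, flipAlg_apply, flip_in1, flip_in2, add_comm (in2 U H2)]
  exact commute_R_of_commute parity_H2 relations.HH.symm (Commute.refl _) (c := -1)
    (by rw [neg_smul, one_smul, relations.h₂_mul_e, sub_eq_add_neg])
    (by rw [neg_smul, one_smul, relations.h₂_mul_f, sub_neg_eq_add])

theorem R_mul_comul (x : U) : R * comul x = flip (comul x) * R := by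
  obtain ⟨r, hr⟩ := isUnit_R
  -- Since `R` is invertible, conjugating `Δ` by it is a homomorphism, so comparison with the
  -- opposite coproduct on generators is enough.
  let φ : U →ₐ[Ch] T2 U := AlgHom.ofLinearMap
    (LinearMap.mulLeft Ch (r : T2 U) ∘ₗ LinearMap.mulRight Ch (↑r⁻¹ : T2 U) ∘ₗ comul.toLinearMap)
    (by simp) (by intro x y; simp [mul_assoc])
  have hφ : ∀ x, φ x = R * (comul x * ↑r⁻¹) := fun x => by rw [← hr]; rfl
  have key : ∀ x, R * comul x = flipAlg U (comul x) * R → φ x = flipAlg U (comul x) := by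
    intro x hx
    rw [hφ, ← mul_assoc, hx, ← hr, mul_assoc, Units.mul_inv, mul_one]
  have h : φ = (flipAlg U).comp comul :=
    algHom_ext (key _ intertwines_E) (key _ intertwines_F) (key _ intertwines_H1)
      (key _ intertwines_H2)
  have hx := AlgHom.congr_fun h x
  rw [hφ, AlgHom.comp_apply, flipAlg_apply] at hx
  rw [← hx, ← hr, mul_assoc, mul_assoc, Units.inv_mul, mul_one]

/-! ### The hexagon identities -/

theorem leg13_R : leg13 R = (1 + (q - q⁻¹) • (leg1 U F * leg3 U E)) * leg13Alg U Upsilon := by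
  rw [← leg13Alg_apply, R, Theta_eq, map_mul, map_add, map_one, map_smul, map_mul, leg13Alg_in1,
    leg13Alg_in2]

theorem leg23_R : leg23 R = (1 + (q - q⁻¹) • (leg2 U F * leg3 U E)) * leg23Alg U Upsilon := by
  rw [← leg23Alg_apply, R, Theta_eq, map_mul, map_add, map_one, map_smul, map_mul, leg23Alg_in1,
    leg23Alg_in2]

theorem leg12_R : leg12 R = (1 + (q - q⁻¹) • (leg1 U F * leg2 U E)) * leg12Alg U Upsilon := by
  rw [← leg12Alg_apply, R, Theta_eq, map_mul, map_add, map_one, map_smul, map_mul, leg12Alg_in1,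
    leg12Alg_in2]

theorem leg13_Upsilon : leg13Alg U Upsilon
    = hExp (leg1 U H1 * leg3 U H1 - leg1 U H2 * leg3 U H2) := by
  rw [Upsilon_eq, map_hExp, map_sub, map_mul, map_mul]
  simp only [leg13Alg_in1, leg13Alg_in2]

theorem leg23_Upsilon : leg23Alg U Upsilon
    = hExp (leg2 U H1 * leg3 U H1 - leg2 U H2 * leg3 U H2) := by
  rw [Upsilon_eq, map_hExp, map_sub, map_mul, map_mul]
  simp only [leg23Alg_in1, leg23Alg_in2]

theorem leg12_Upsilon : leg12Alg U Upsilon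
    = hExp (leg1 U H1 * leg2 U H1 - leg1 U H2 * leg2 U H2) := by
  rw [Upsilon_eq, map_hExp, map_sub, map_mul, map_mul]
  simp only [leg12Alg_in1, leg12Alg_in2]

theorem leg13_Upsilon_mul_leg2 (x : U) :
    leg13Alg U Upsilon * leg2 U x = leg2 U x * leg13Alg U Upsilon := by
  rw [leg13_Upsilon]
  refine (Commute.hExp_left (Commute.sub_left ?_ ?_)).eq
  · exact Commute.mul_left ((superCommute_leg12 U).symm.even _ _ parity_H1).symm
      ((superCommute_leg23 U).even _ _ parity_H1).symm
  · exact Commute.mul_left ((superCommute_leg12 U).symm.even _ _ parity_H2).symm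
      ((superCommute_leg23 U).even _ _ parity_H2).symm

/-- The images of even elements with commuting components in three legs commute. -/
theorem commute_exponents {f g g' : U →ₐ[Ch] T3 U} (hfg : SuperCommute f g)
    (hfg' : SuperCommute f g') (hgg' : SuperCommute g g') :
    Commute (f H1 * g H1 - f H2 * g H2) (f H1 * g' H1 - f H2 * g' H2) := by
  have hf : ∀ {x y : U}, Commute x y → Commute (f x) (f y) := fun h => h.map f
  have h12 : Commute H1 H2 := relations.HH
  have key : ∀ {x y : U}, parity U x = x → parity U y = y → Commute x y →
      Commute (f x * g x) (f y * g' y) := fun {x y} hx hy hxy =>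
    Commute.mul_left ((hf hxy).mul_right (hfg'.even x y hy))
      (Commute.mul_right (hfg.even y x hx).symm (hgg'.even x y hy))
  exact Commute.sub_left
    ((key parity_H1 parity_H1 (Commute.refl _)).sub_right (key parity_H1 parity_H2 h12))
    ((key parity_H2 parity_H1 h12.symm).sub_right (key parity_H2 parity_H2 (Commute.refl _)))

/-- Primitivity of the `H_i` splits the exponent into the `13` and `23` exponents, and these
commute. -/
theorem coprodLeft_Upsilon : coprodLeftAlg comul comul_parity Upsilon
    = leg13Alg U Upsilon * leg23Alg U Upsilon := by
  rw [leg13_Upsilon, leg23_Upsilon, ← hExp_add, Upsilon_eq, map_hExp]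
  · congr 1
    simp only [map_sub, map_mul, coprodLeftAlg_in1, coprodLeftAlg_in2, comul_H1, comul_H2, map_add,
      leg12Alg_in1, leg12Alg_in2, add_mul]
    abel
  · have h := commute_exponents (superCommute_leg13 U).symm (superCommute_leg23 U).symm
      (superCommute_leg12 U)
    -- `commute_exponents` puts the shared leg first; here that is the third leg, so the products
    -- have to be reordered.
    have e : ∀ {f : U →ₐ[Ch] T3 U}, SuperCommute f (leg3 U) →
        leg3 U H1 * f H1 - leg3 U H2 * f H2 = f H1 * leg3 U H1 - f H2 * leg3 U H2 := fun hf => by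
      rw [hf.even _ _ parity_H1, hf.even _ _ parity_H2]
    rwa [e (superCommute_leg13 U), e (superCommute_leg23 U)] at h

theorem coprodRight_Upsilon : coprodRightAlg comul comul_parity Upsilon
    = leg13Alg U Upsilon * leg12Alg U Upsilon := by
  rw [leg13_Upsilon, leg12_Upsilon, ← hExp_add, Upsilon_eq, map_hExp]
  · congr 1
    simp only [map_sub, map_mul, coprodRightAlg_in1, coprodRightAlg_in2, comul_H1, comul_H2,
      map_add, leg23Alg_in1, leg23Alg_in2, mul_add]
    abel
  · exact commute_exponents (superCommute_leg13 U) (superCommute_leg12 U)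
      (superCommute_leg23 U).symm

theorem mul_leg_of_odd {f g : U →ₐ[Ch] T3 U} (h : SuperCommute f g) {x y : U}
    (hx : parity U x = -x) (hy : parity U y = -y) : g y * f x = -(f x * g y) := by
  rw [h.symm.odd y x hx, hy, map_neg, mul_neg]

theorem coprodLeft_R : coprodLeft comul R = leg13 R * leg23 R := by
  -- The `K` created in the first leg is the one of the summand `K ⊗ F` of `Δ(F)`.
  have hu : leg13Alg U Upsilon * leg3 U E = leg3 U E * leg1 U K * leg13Alg U Upsilon := by
    have := congrArg (leg13Alg U) Upsilon_mul_in2_E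
    simpa only [map_mul, leg13Alg_in1, leg13Alg_in2] using this
  have hR : coprodLeftAlg comul comul_parity R = coprodLeftAlg comul comul_parity Theta *
      coprodLeftAlg comul comul_parity Upsilon := map_mul _ _ _
  have hT : coprodLeftAlg comul comul_parity Theta
      = 1 + (q - q⁻¹) • ((leg1 U F + leg1 U K * leg2 U F) * leg3 U E) := by
    simp only [Theta_eq, map_add, map_one, map_smul, map_mul, coprodLeftAlg_in1, coprodLeftAlg_in2,
      comul_F, leg12Alg_in1, leg12Alg_in2]
  rw [← coprodLeftAlg_apply comul comul_parity, hR, hT, coprodLeft_Upsilon, leg13_R, leg23_R]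
  refine comul_left_identity hu (leg13_Upsilon_mul_leg2 F) ?_
    (mul_leg_of_odd (superCommute_leg23 U) parity_F parity_E)
    ((superCommute_leg13 U).symm.even _ _ parity_K) ((superCommute_leg12 U).symm.even _ _ parity_K)
  rw [← map_mul, relations.EE, map_zero]

theorem coprodRight_R : coprodRight comul R = leg13 R * leg12 R := by
  have hu : leg13Alg U Upsilon * leg1 U F = leg1 U F * leg3 U Kinv * leg13Alg U Upsilon := by
    have := congrArg (leg13Alg U) Upsilon_mul_in1_F
    simpa only [map_mul, leg13Alg_in1, leg13Alg_in2] using this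
  have hR : coprodRightAlg comul comul_parity R = coprodRightAlg comul comul_parity Theta *
      coprodRightAlg comul comul_parity Upsilon := map_mul _ _ _
  have hT : coprodRightAlg comul comul_parity Theta
      = 1 + (q - q⁻¹) • (leg1 U F * (leg2 U E * leg3 U Kinv + leg3 U E)) := by
    simp only [Theta_eq, map_add, map_one, map_smul, map_mul, coprodRightAlg_in1,
      coprodRightAlg_in2, comul_E, leg23Alg_in1, leg23Alg_in2]
  rw [← coprodRightAlg_apply comul comul_parity, hR, hT, coprodRight_Upsilon, leg13_R, leg12_R]
  refine comul_right_identity hu (leg13_Upsilon_mul_leg2 E) ?_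
    (mul_leg_of_odd (superCommute_leg13 U) parity_F parity_E)
    ((superCommute_leg23 U).even _ _ parity_Kinv).symm
  rw [← map_mul, relations.FF, map_zero]

theorem isUniversalRMatrix : IsUniversalRMatrix comul R where
  invertible := isUnit_R
  intertwines := R_mul_comul
  comul_left := coprodLeft_R
  comul_right := coprodRight_R

end U

end SuperHopf

end

theorem proposition2 :
    ∃ (Δ : SuperHopf.U →ₐ[SuperHopf.Ch] SuperHopf.T2 SuperHopf.U)
      (ε : SuperHopf.U →ₐ[SuperHopf.Ch] SuperHopf.Ch)
      (S : SuperHopf.U →ₗ[SuperHopf.Ch] SuperHopf.U),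
      SuperHopf.U.IsStructureMaps Δ ε S ∧
      (∀ Δ' ε' S', SuperHopf.U.IsStructureMaps Δ' ε' S' → Δ' = Δ ∧ ε' = ε ∧ S' = S) ∧
      SuperHopf.IsHopfSuperalgebra Δ ε S ∧
      SuperHopf.IsUniversalRMatrix Δ SuperHopf.U.R :=
  ⟨SuperHopf.U.comul, SuperHopf.U.counit, SuperHopf.U.antipode, SuperHopf.U.isStructureMaps,
    fun _ _ _ h => SuperHopf.U.isStructureMaps_unique h, SuperHopf.U.isHopfSuperalgebra,
    SuperHopf.U.isUniversalRMatrix⟩
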